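/- Let $\mathcal H$ be a complex Hilbert space (of arbitrary dimension), let $(\rho_t)_t$ be a family of density operators on $\mathcal H$ (positive operators of trace $1$) indexed by a set of times $t$, and let $\{A_k\}_k$ be bounded operators on $\mathcal H$ with $\sum_k A_k^\dagger A_k=\mathbb 1$ (the Kraus operators of the measurement). Suppose that the measurement leaves every state of the clock unchanged: $\sum_k A_k\rho_tA_k^\dagger=\rho_t$ for all $t$. (Infinite sums of operators converge in the strong operator topology.) Let $\mathcal H_0\subseteq\mathcal H$ be the joint support of the states, i.e. the closed linear span of the ranges of all the $\rho_t$; when the states do not all live on a smaller closed subspace, $\mathcal H_0=\mathcal H$. Then there are a set of indices $n$, Hilbert spaces $\mathcal H_{C_n}$ and $\mathcal H_{F_n}$, and a unitary identification $$\mathcal H_0=\bigoplus_n \mathcal H_{C_n}\otimes\mathcal H_{F_n}$$ such that, for all $t$, $$\rho_t=\bigoplus_n p_{n|t}\,\rho_{n|t}\otimes\omega_n \quad\text{on }\mathcal H_0$$ (and $\rho_t=0$ on $\mathcal H_0^\perp$), where - $\omega_n$ is a density operator on $\mathcal H_{F_n}$ that does not depend on $t$, - $p_{n|t}\ge 0$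 and $\sum_n p_{n|t}=1$ for all $t$, - $\rho_{n|t}$ is a density operator on $\mathcal H_{C_n}$ for all $n$ and $t$. Furthermore, there are bounded operators $A_{k,n}$ on $\mathcal H_{F_n}$ such that every Kraus operator maps $\mathcal H_0$ into itself and has the form $$A_k=\bigoplus_n \mathbb 1_{C_n}\otimes A_{k,n}\quad\text{on }\mathcal H_0,$$ and $\sum_k A_{k,n}\,\omega_n\,A_{k,n}^\dagger=\omega_n$ for all $n$. -/

import Mathlib

open scoped TensorProduct

universe u

namespace TickingClock

noncomputable section

/-- The Hilbert space tensor product: the completion of the algebraic tensor product with respect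
to the inner product determined by `⟪c ⊗ f, c' ⊗ f'⟫ = ⟪c, c'⟫ * ⟪f, f'⟫`. -/
abbrev HilbertTensor (C F : Type u) [NormedAddCommGroup C] [InnerProductSpace ℂ C]
    [NormedAddCommGroup F] [InnerProductSpace ℂ F] : Type u :=
  UniformSpace.Completion (C ⊗[ℂ] F)

/-- The bounded operator `a ⊗ b` on the Hilbert space tensor product. -/
def opTensor {C F : Type u} [NormedAddCommGroup C] [InnerProductSpace ℂ C]
    [NormedAddCommGroup F] [InnerProductSpace ℂ F] (a : C →L[ℂ] C) (b : F →L[ℂ] F) :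
    HilbertTensor C F →L[ℂ] HilbertTensor C F :=
  (TensorProduct.mapL a b).completion

section Operators

variable {H : Type u} [NormedAddCommGroup H] [InnerProductSpace ℂ H]

/-- A density operator (normalised state): a positive bounded operator whose trace,
computed in any orthonormal basis, is `1` (so that it is trace class).
Every Hilbert space has orthonormal bases, and each can be indexed by a subset of the space. -/
structure IsDensityOperator (ρ : H →L[ℂ] H) : Prop where
  isPositive : ρ.IsPositive
  hasTrace_one : ∀ (s : Set H) (b : HilbertBasis s ℂ H),
    HasSum (fun i : s => inner ℂ (b i) (ρ (b i))) (1 : ℂ)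

/-- The smallest closed subspace that carries all the states `ρ t`:
the closed linear span of their ranges. -/
def jointSupport {T : Type*} (ρ : T → H →L[ℂ] H) : Submodule ℂ H :=
  (⨆ t, LinearMap.range (ρ t : H →ₗ[ℂ] H)).topologicalClosure

variable [CompleteSpace H]

/-- `∑ k, A k† A k = 1`, with convergence in the strong operator topology. -/
def IsKrausFamily {κ : Type*} (A : κ → H →L[ℂ] H) : Prop :=
  ∀ x : H, HasSum (fun k => ((A k).adjoint ∘L A k) x) x

/-- `∑ k, A k σ A k† = σ`, with convergence in the strong operator topology. -/
def Preserves {κ : Type*} (A : κ → H →L[ℂ] H) (σ : H →L[ℂ] H) : Prop :=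
  ∀ x : H, HasSum (fun k => (A k ∘L σ ∘L (A k).adjoint) x) (σ x)

end Operators

/-- An identification of a Hilbert space `K` with a Hilbert direct sum `⨁ n, C n ⊗ F n`
of tensor products of Hilbert spaces. -/
structure TensorSplitting (K : Type u) [NormedAddCommGroup K] [InnerProductSpace ℂ K] where
  /-- the values of the register -/
  ι : Type u
  /-- the clockwork spaces -/
  C : ι → Type u
  /-- the display spaces -/
  F : ι → Type u
  [normC : ∀ n, NormedAddCommGroup (C n)]
  [innerC : ∀ n, InnerProductSpace ℂ (C n)]
  [completeC : ∀ n, CompleteSpace (C n)]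
  [normF : ∀ n, NormedAddCommGroup (F n)]
  [innerF : ∀ n, InnerProductSpace ℂ (F n)]
  [completeF : ∀ n, CompleteSpace (F n)]
  /-- the unitary identification -/
  iso : lp (fun n => HilbertTensor (C n) (F n)) 2 ≃ₗᵢ[ℂ] K

attribute [instance] TensorSplitting.normC TensorSplitting.innerC TensorSplitting.completeC
  TensorSplitting.normF TensorSplitting.innerF TensorSplitting.completeF

open Classical in
/-- The inclusion of the `n`-th summand `C n ⊗ F n` in `K`. -/
def TensorSplitting.incl {K : Type u} [NormedAddCommGroup K] [InnerProductSpace ℂ K]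
    (D : TensorSplitting K) (n : D.ι) (v : HilbertTensor (D.C n) (D.F n)) : K :=
  D.iso (lp.single 2 n v)

/-- The restriction of the bounded operator `B` to the subspace `K` is the direct sum `⨁ n, S n`:
on the `n`-th summand of `K` it acts as `S n`. The summands span a dense subspace of `K`,
so this determines `B` on `K`, and it forces `B` to map the closed subspace `K` to itself. -/
def TensorSplitting.IsDirectSum {H : Type u} [NormedAddCommGroup H] [InnerProductSpace ℂ H]
    {K : Submodule ℂ H} (D : TensorSplitting K) (B : H →L[ℂ] H)
    (S : ∀ n, HilbertTensor (D.C n) (D.F n) →L[ℂ] HilbertTensor (D.C n) (D.F n)) : Prop :=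
  ∀ (n : D.ι) (v : HilbertTensor (D.C n) (D.F n)), B (D.incl n v : H) = (D.incl n (S n v) : H)

end

end TickingClock

/-!
The theorem is the Koashi–Imoto decomposition in arbitrary dimension. It comes from the
structure of the commutant `N` of the Kraus operators and their adjoints on the joint support of
the states.

*Restriction to the joint support.* If `ρ t v = 0`, then `∑ k, ⟪(A k)† v, ρ t ((A k)† v)⟫ = 0`, so
the orthogonal complement of the support is invariant under the adjoints and the support is
invariant under the Kraus operators. It may therefore be taken to be the whole space, so that the
states are jointly faithful (`exists_splitting`).

*Conditional expectation.* A Banach limit of the iterates of the Heisenberg evolution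
`Φ X = ∑ k, A k† X A k` is a contraction `E` into the fixed points of `Φ` that preserves all the
states. On vectors of an invariant state, a fixed point `Y` commutes with the Kraus operators,
because the squared commutators add up to the expectation value of `Φ (Y† Y) - Y† Y`, which
vanishes. By faithfulness, `E` maps into `N`, and it is a bimodule map over `N`
(`exists_conditionalExpectation`).

*Irreducible subspaces.* The existence of `E` forces `N` to be atomic. For `h = E |e⟩⟨e|` and a
nonzero projection `r` of `N` below a spectral projection of `h` for values above `c > 0`, the
bimodule property gives `c ≤ ‖r h r‖ = ‖E |r e⟩⟨r e|‖ ≤ ‖r e‖ ^ 2`. As `‖r e‖ ^ 2` is additive in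
`r`, a projection for which it is almost minimal is minimal
(`ConditionalExpectation.exists_irreducible_le`). Zorn's lemma then decomposes the space into
irreducible reducing subspaces.

*Splitting.* The irreducible subspaces are sorted into classes `n` by equivalence in `N`. If `F n`
is a representative of the class `n` and `J n` is the set of its members, then partial isometries
`w i` in `N` identify the span of the members with `ℓ²(J n) ⊗ F n`, and the Kraus operators, which
commute with the `w i`, act as `1 ⊗ a`. For `f` and `f'` in `F n`, Schur's lemma says that
`E |f'⟩⟨f|` is a multiple `B f f'` of the projection onto `F n`, and invariance of the states under
`E` turns the block `⟪w i f, ρ t (w j f')⟫` into `tr (ρ t * w j * (w i)†) * B f f'`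
(`ConditionalExpectation.exists_form`). So the form `B`, which does not depend on `t`, gives the
state `ω n`, and the first factor gives the state on `ℓ²(J n)`. Between different classes
`E |f'⟩⟨f|` vanishes, and so do the blocks (`ConditionalExpectation.inner_eq_zero`).
-/

namespace TickingClock

open Filter Topology BoundedContinuousFunction InnerProductSpace ContinuousLinearMap
open scoped ENNReal

/-! ### Banach limits -/

/-- A Banach limit: a shift-invariant state on the bounded sequences. It exchanges with norm
convergent sums (`BanachLimit.hasSum`), which is what makes averages of normal maps tractable. -/
structure BanachLimit where
  /-- the underlying functional -/
  toCLM : (ℕ →ᵇ ℂ) →L[ℂ] ℂ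
  norm_le : ∀ z, ‖toCLM z‖ ≤ ‖z‖
  shift : ∀ z w : ℕ →ᵇ ℂ, (∀ n, w n = z (n + 1)) → toCLM w = toCLM z
  const : ∀ (c : ℂ) (z : ℕ →ᵇ ℂ), (∀ n, z n = c) → toCLM z = c
  conj : ∀ z : ℕ →ᵇ ℂ, toCLM (star z) = star (toCLM z)

/-- The Cesàro means of a bounded sequence converge along any ultrafilter. -/
lemma exists_tendsto_cesaro (z : ℕ →ᵇ ℂ) : ∃ a : ℂ, ‖a‖ ≤ ‖z‖ ∧
    Tendsto (fun n : ℕ => ((n : ℂ) + 1)⁻¹ * ∑ j ∈ Finset.range (n + 1), z j)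
      (hyperfilter ℕ : Filter ℕ) (𝓝 a) := by
  have hb : ∀ n : ℕ, ‖((n : ℂ) + 1)⁻¹ * ∑ j ∈ Finset.range (n + 1), z j‖ ≤ ‖z‖ := by
    intro n
    rw [norm_mul, norm_inv]
    have h1 : ‖(n : ℂ) + 1‖ = n + 1 := by
      rw [← Nat.cast_succ, Complex.norm_natCast, Nat.cast_succ]
    have h2 : ‖∑ j ∈ Finset.range (n + 1), z j‖ ≤ (n + 1) * ‖z‖ := by
      refine (norm_sum_le_of_le _ (fun j _ => z.norm_coe_le_norm j)).trans ?_
      simp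
    rw [h1, inv_mul_le_iff₀ (by positivity)]
    exact h2
  obtain ⟨a, ha, hl⟩ := (isCompact_closedBall (0 : ℂ) ‖z‖).ultrafilter_le_nhds'
    ((hyperfilter ℕ).map (fun n : ℕ => ((n : ℂ) + 1)⁻¹ * ∑ j ∈ Finset.range (n + 1), z j))
    (by
      rw [Ultrafilter.mem_map]
      refine Filter.univ_mem' (fun n => ?_)
      simpa using hb n)
  exact ⟨a, by simpa using ha, hl⟩

theorem exists_banachLimit : Nonempty BanachLimit := by
  choose L hLb hL using exists_tendsto_cesaro
  have huniq : ∀ z a, Tendsto (fun n : ℕ => ((n : ℂ) + 1)⁻¹ * ∑ j ∈ Finset.range (n + 1), z j)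
      (hyperfilter ℕ : Filter ℕ) (𝓝 a) → L z = a := fun z a h => tendsto_nhds_unique (hL z) h
  refine ⟨⟨LinearMap.mkContinuous ⟨⟨L, ?_⟩, ?_⟩ 1 ?_, ?_, ?_, ?_, ?_⟩⟩
  · intro z w
    refine huniq _ _ (((hL z).add (hL w)).congr (fun n => ?_))
    simp [Finset.sum_add_distrib, mul_add]
  · intro c z
    refine huniq _ _ (((hL z).const_mul c).congr (fun n => ?_))
    simp only [BoundedContinuousFunction.coe_smul, smul_eq_mul, ← Finset.mul_sum]
    ring
  · intro z
    simpa using hLb z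
  · intro z
    exact hLb z
  · intro z w h
    refine huniq w _ ?_
    have h0 : Tendsto (fun n : ℕ => ((n : ℂ) + 1)⁻¹ * (z (n + 1) - z 0))
        (hyperfilter ℕ : Filter ℕ) (𝓝 0) := by
      refine Tendsto.mono_left ?_ (Nat.hyperfilter_le_atTop)
      refine squeeze_zero_norm (a := fun n : ℕ => (1 / ((n : ℝ) + 1)) * (‖z‖ + ‖z‖)) ?_ ?_
      · intro n
        rw [norm_mul, norm_inv, one_div, ← Nat.cast_succ, Complex.norm_natCast, Nat.cast_succ]
        gcongr
        exact (norm_sub_le _ _).trans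
          (add_le_add (z.norm_coe_le_norm _) (z.norm_coe_le_norm _))
      · simpa using tendsto_one_div_add_atTop_nhds_zero_nat.mul_const (‖z‖ + ‖z‖)
    have := (hL z).add h0
    rw [add_zero] at this
    refine this.congr (fun n => ?_)
    rw [← mul_add, Finset.sum_congr rfl (fun j _ => h j), Finset.sum_range_succ' (fun j => z j),
      Finset.sum_range_succ (fun j => z (j + 1))]
    ring
  · intro c z h
    refine huniq z c (tendsto_const_nhds.congr (fun n => ?_))
    have : (n : ℂ) + 1 ≠ 0 := by exact_mod_cast n.succ_ne_zero
    simp only [h, Finset.sum_const, Finset.card_range, nsmul_eq_mul]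
    push_cast
    field_simp
  · intro z
    refine huniq _ _ (((Complex.continuous_conj.tendsto _).comp (hL z)).congr (fun n => ?_))
    simp

/-- Dominated summation: the series converges in norm in the space of bounded sequences. -/
lemma BanachLimit.hasSum (M : BanachLimit) {κ : Type*} (z : κ → ℕ →ᵇ ℂ) (w : ℕ →ᵇ ℂ) (c : κ → ℝ)
    (hc : Summable c) (hz : ∀ k n, ‖z k n‖ ≤ c k)
    (hw : ∀ n, HasSum (fun k => z k n) (w n)) : HasSum (fun k => M.toCLM (z k)) (M.toCLM w) := by
  have hs : Summable z := by
    refine Summable.of_norm_bounded hc (fun k => ?_)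
    exact (BoundedContinuousFunction.norm_le ((norm_nonneg _).trans (hz k 0))).2 (hz k)
  have : ∑' k, z k = w := by
    ext n
    exact (hs.hasSum.mapL (BoundedContinuousFunction.evalCLM ℂ n)).unique (hw n)
  rw [← this]
  exact hs.hasSum.mapL M.toCLM

/-! ### Hilbert–Schmidt sums -/

section HilbertSchmidt

variable {H G : Type*} [NormedAddCommGroup H] [InnerProductSpace ℂ H]
  [NormedAddCommGroup G] [InnerProductSpace ℂ G]

lemma enorm_inner_sq {x y : H} : ‖inner ℂ x y‖ₑ ^ 2 = ‖inner ℂ y x‖ₑ ^ 2 := by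
  rw [← inner_conj_symm, RCLike.enorm_conj]

lemma inner_self_ofReal (x : H) : inner ℂ x x = ((‖x‖ ^ 2 : ℝ) : ℂ) := by
  rw [inner_self_eq_norm_sq_to_K]
  norm_cast

lemma hasSum_norm_inner_sq {ι : Type*} (b : HilbertBasis ι ℂ H) (x : H) :
    HasSum (fun i => ‖inner ℂ (b i) x‖ ^ 2) (‖x‖ ^ 2) := by
  have h := b.hasSum_inner_mul_inner x x
  rw [inner_self_eq_norm_sq_to_K] at h
  have h2 : (fun i => inner ℂ x (b i) * inner ℂ (b i) x) =
      fun i => ((‖inner ℂ (b i) x‖ ^ 2 : ℝ) : ℂ) := by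
    ext i
    rw [← inner_conj_symm, RCLike.conj_mul]
    norm_cast
  rw [h2] at h
  have h3 : ((‖x‖ : ℂ)) ^ 2 = ((‖x‖ ^ 2 : ℝ) : ℂ) := by push_cast; rfl
  exact Complex.hasSum_ofReal.1 (by simpa using h)

lemma tsum_ofReal_sq {ι : Type*} {f : ι → ℝ} {a : ℝ} (hf : ∀ i, 0 ≤ f i) (h : HasSum f a) :
    ∑' i, ENNReal.ofReal (f i) = ENNReal.ofReal a := by
  rw [← h.tsum_eq, ENNReal.ofReal_tsum_of_nonneg hf h.summable]

lemma hasSum_of_tsum_ofReal {ι : Type*} {f : ι → ℝ} {a : ℝ} (hf : ∀ i, 0 ≤ f i) (ha : 0 ≤ a)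
    (h : ∑' i, ENNReal.ofReal (f i) = ENNReal.ofReal a) : HasSum f a := by
  have hs : Summable f := by
    have h1 : ∑' i, ENNReal.ofReal (f i) ≠ ∞ := by rw [h]; exact ENNReal.ofReal_ne_top
    refine (ENNReal.summable_toReal h1).congr (fun i => ENNReal.toReal_ofReal (hf i))
  have := tsum_ofReal_sq hf hs.hasSum
  rw [h, ENNReal.ofReal_eq_ofReal_iff ha (tsum_nonneg hf)] at this
  rw [this]
  exact hs.hasSum

lemma ofReal_norm_sq {E : Type*} [SeminormedAddCommGroup E] (x : E) :
    ENNReal.ofReal (‖x‖ ^ 2) = ‖x‖ₑ ^ 2 := by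
  rw [ENNReal.ofReal_pow (norm_nonneg _), ofReal_norm]

lemma hasSum_norm_sq_iff {E ι : Type*} [SeminormedAddCommGroup E] {s : ι → E} {a : ℝ} (ha : 0 ≤ a) :
    HasSum (fun i => ‖s i‖ ^ 2) a ↔ ∑' i, ‖s i‖ₑ ^ 2 = ENNReal.ofReal a := by
  simp_rw [← ofReal_norm_sq]
  exact ⟨tsum_ofReal_sq fun i => by positivity, hasSum_of_tsum_ofReal (fun i => by positivity) ha⟩

lemma tsum_enorm_inner_sq {ι : Type*} (b : HilbertBasis ι ℂ H) (x : H) :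
    ∑' i, ‖inner ℂ (b i) x‖ₑ ^ 2 = ‖x‖ₑ ^ 2 := by
  have := (hasSum_norm_sq_iff (s := fun i => inner ℂ (b i) x) (by positivity)).1
    (hasSum_norm_inner_sq b x)
  rw [this, ofReal_norm_sq]

variable [CompleteSpace H] [CompleteSpace G]

/-- The Hilbert–Schmidt norms of an operator and of its adjoint agree, in all Hilbert bases. -/
lemma tsum_enorm_sq_adjoint {ι ι' : Type*} (b : HilbertBasis ι ℂ H) (c : HilbertBasis ι' ℂ G)
    (X : H →L[ℂ] G) : ∑' i, ‖X (b i)‖ₑ ^ 2 = ∑' j, ‖adjoint X (c j)‖ₑ ^ 2 := by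
  simp_rw [← tsum_enorm_inner_sq c (X _), ← tsum_enorm_inner_sq b (adjoint X _)]
  rw [ENNReal.tsum_comm]
  refine tsum_congr fun j => tsum_congr fun i => ?_
  rw [ContinuousLinearMap.adjoint_inner_right, enorm_inner_sq]

lemma exists_basis (H : Type*) [NormedAddCommGroup H] [InnerProductSpace ℂ H] [CompleteSpace H] :
    ∃ (w : Set H), Nonempty (HilbertBasis w ℂ H) :=
  let ⟨w, b, _⟩ := exists_hilbertBasis (𝕜 := ℂ) (E := H)
  ⟨w, ⟨b⟩⟩

lemma exists_sqrt {X : H →L[ℂ] H} (hX : X.IsPositive) :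
    ∃ Y : H →L[ℂ] H, adjoint Y = Y ∧ Y ∘L Y = X := by
  have hX' : 0 ≤ X := X.nonneg_iff_isPositive.2 hX
  refine ⟨CFC.sqrt X, ?_, CFC.sqrt_mul_sqrt_self X hX'⟩
  have : (CFC.sqrt X).IsPositive := (nonneg_iff_isPositive _).1 (CFC.sqrt_nonneg X)
  exact this.isSelfAdjoint

lemma inner_sqrt {X Y : H →L[ℂ] H} (hY : adjoint Y = Y) (h : Y ∘L Y = X) (x y : H) :
    inner ℂ x (X y) = inner ℂ (Y x) (Y y) := by
  rw [← h, ContinuousLinearMap.comp_apply, ← ContinuousLinearMap.adjoint_inner_left, hY]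

lemma inner_sqrt_self {X Y : H →L[ℂ] H} (hY : adjoint Y = Y) (h : Y ∘L Y = X) (x : H) :
    inner ℂ x (X x) = ((‖Y x‖ ^ 2 : ℝ) : ℂ) := by
  rw [inner_sqrt hY h, inner_self_eq_norm_sq_to_K]
  norm_cast

/-- The trace of a positive operator may be computed in a single Hilbert basis, as the squared
Hilbert–Schmidt norm of its square root. -/
lemma isDensityOperator_of_sqrt {ρ S : H →L[ℂ] H} (hS : adjoint S = S) (h : S ∘L S = ρ)
    {ι : Type*} (b : HilbertBasis ι ℂ H) (h1 : HasSum (fun i => ‖S (b i)‖ ^ 2) 1) :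
    IsDensityOperator ρ := by
  constructor
  · rw [← h]
    nth_rw 1 [← hS]
    exact isPositive_adjoint_comp_self S
  · intro s c
    rw [hasSum_norm_sq_iff zero_le_one, tsum_enorm_sq_adjoint b c, hS,
      ← hasSum_norm_sq_iff zero_le_one] at h1
    have := Complex.hasSum_ofReal.2 h1
    simpa only [inner_sqrt_self hS h, Complex.ofReal_one] using this

lemma isDensityOperator_of_hasSum {ρ : H →L[ℂ] H} (hρ : ρ.IsPositive)
    {ι : Type*} (b : HilbertBasis ι ℂ H) (h1 : HasSum (fun i => inner ℂ (b i) (ρ (b i))) 1) :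
    IsDensityOperator ρ := by
  obtain ⟨S, hS, h⟩ := exists_sqrt hρ
  refine isDensityOperator_of_sqrt hS h b ?_
  simp only [inner_sqrt_self hS h] at h1
  exact Complex.hasSum_ofReal.1 (by simpa using h1)

lemma IsDensityOperator.hasSum_sqrt {ρ S : H →L[ℂ] H} (hρ : IsDensityOperator ρ)
    (hS : adjoint S = S) (h : S ∘L S = ρ) {ι : Type*} (b : HilbertBasis ι ℂ H) :
    HasSum (fun i => ‖S (b i)‖ ^ 2) 1 := by
  obtain ⟨w, ⟨c⟩⟩ := exists_basis H
  have h1 := hρ.hasTrace_one w c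
  simp only [inner_sqrt_self hS h] at h1
  have h2 : HasSum (fun i => ‖S (c i)‖ ^ 2) 1 := Complex.hasSum_ofReal.1 (by simpa using h1)
  rw [hasSum_norm_sq_iff zero_le_one] at h2 ⊢
  rw [← h2, tsum_enorm_sq_adjoint b c, hS]

end HilbertSchmidt

/-! ### The measurement in the Heisenberg picture -/

section Heisenberg

variable {K : Type*} [NormedAddCommGroup K] [InnerProductSpace ℂ K]

lemma hasSum_inner_left {ι : Type*} {f : ι → K} {a : K} (h : HasSum f a) (x : K) :
    HasSum (fun i => inner ℂ x (f i)) (inner ℂ x a) :=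
  h.mapL (innerSL ℂ x)

variable [CompleteSpace K] {κ : Type*} {A : κ → K →L[ℂ] K}

lemma IsKrausFamily.hasSum_norm_sq (hA : IsKrausFamily A) (x : K) :
    HasSum (fun k => ‖A k x‖ ^ 2) (‖x‖ ^ 2) := by
  have h := hasSum_inner_left (hA x) x
  refine Complex.hasSum_ofReal.1 ?_
  convert h using 1
  · ext k
    rw [ContinuousLinearMap.comp_apply,
      ContinuousLinearMap.adjoint_inner_right, inner_self_eq_norm_sq_to_K]
    norm_cast
  · rw [inner_self_eq_norm_sq_to_K]
    norm_cast

/-- The isometry `x ↦ (A k x)ₖ` into the Hilbert sum of copies of the space: the Stinespring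
dilation of the measurement. -/
noncomputable def krausIsometry (hA : IsKrausFamily A) : K →ₗᵢ[ℂ] lp (fun _ : κ => K) 2 where
  toFun x := ⟨fun k => A k x, (memℓp_gen_iff (by norm_num)).2 (by
    simpa using (hA.hasSum_norm_sq x).summable)⟩
  map_add' x y := by ext k; simp; rfl
  map_smul' c x := by ext k; simp
  norm_map' x := by
    have h := lp.norm_rpow_eq_tsum (p := 2) (by norm_num)
      (⟨fun k => A k x, (memℓp_gen_iff (by norm_num)).2 (by
        simpa using (hA.hasSum_norm_sq x).summable)⟩ : lp (fun _ : κ => K) 2)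
    have h2 := (hA.hasSum_norm_sq x).tsum_eq
    simp only [ENNReal.toReal_ofNat, Real.rpow_ofNat] at h
    rw [h2] at h
    exact (sq_eq_sq₀ (norm_nonneg _) (norm_nonneg _)).1 h

/-- The operator `∑ k, A k† X A k`. -/
noncomputable def krausPullback (hA : IsKrausFamily A) (X : K →L[ℂ] K) : K →L[ℂ] K :=
  adjoint (krausIsometry hA).toContinuousLinearMap ∘L
    lp.mapCLM 2 (fun _ => X) (norm_nonneg X) (fun _ => le_rfl) ∘L
    (krausIsometry hA).toContinuousLinearMap

lemma hasSum_inner_krausPullback (hA : IsKrausFamily A) (X : K →L[ℂ] K) (x y : K) :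
    HasSum (fun k => inner ℂ (A k x) (X (A k y))) (inner ℂ x (krausPullback hA X y)) := by
  have h := lp.hasSum_inner (𝕜 := ℂ) (krausIsometry hA x)
    (lp.mapCLM 2 (fun _ => X) (norm_nonneg X) (fun _ => le_rfl) (krausIsometry hA y))
  have h2 : inner ℂ x (krausPullback hA X y) = inner ℂ (krausIsometry hA x)
    (lp.mapCLM 2 (fun _ => X) (norm_nonneg X) (fun _ => le_rfl) (krausIsometry hA y)) :=
    ContinuousLinearMap.adjoint_inner_right (krausIsometry hA).toContinuousLinearMap x _
  rw [h2]
  exact h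

lemma norm_krausPullback_le (hA : IsKrausFamily A) (X : K →L[ℂ] K) :
    ‖krausPullback hA X‖ ≤ ‖X‖ := by
  refine ContinuousLinearMap.opNorm_le_bound _ (norm_nonneg _) fun y => ?_
  have h1 : ‖adjoint (krausIsometry hA).toContinuousLinearMap‖ ≤ 1 := by
    rw [LinearIsometryEquiv.norm_map]
    exact LinearIsometry.norm_toContinuousLinearMap_le _
  have h2 := lp.norm_mapCLM_le (α := κ) 2 (fun _ => X) (norm_nonneg X) (fun _ => le_rfl)
  refine (ContinuousLinearMap.le_of_opNorm_le _ h1 _).trans ?_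
  rw [one_mul]
  refine (ContinuousLinearMap.le_of_opNorm_le _ h2 _).trans_eq ?_
  congr 1
  exact (krausIsometry hA).norm_map y

/-- The Heisenberg picture `X ↦ ∑ k, A k† X A k` of the measurement, as a contraction. -/
noncomputable def heisenberg (hA : IsKrausFamily A) : (K →L[ℂ] K) →L[ℂ] (K →L[ℂ] K) :=
  LinearMap.mkContinuous
    { toFun := krausPullback hA
      map_add' := fun X Y => by
        ext y
        refine ext_inner_left ℂ fun x => (hasSum_inner_krausPullback hA _ x y).unique ?_
        simpa only [_root_.add_apply, inner_add_right] using
          (hasSum_inner_krausPullback hA X x y).add (hasSum_inner_krausPullback hA Y x y)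
      map_smul' := fun c X => by
        ext y
        refine ext_inner_left ℂ fun x => (hasSum_inner_krausPullback hA _ x y).unique ?_
        simpa only [_root_.smul_apply, inner_smul_right, RingHom.id_apply] using
          (hasSum_inner_krausPullback hA X x y).mul_left c } 1
    (fun X => by simpa using norm_krausPullback_le hA X)

lemma hasSum_inner_heisenberg (hA : IsKrausFamily A) (X : K →L[ℂ] K) (x y : K) :
    HasSum (fun k => inner ℂ (A k x) (X (A k y))) (inner ℂ x (heisenberg hA X y)) :=
  hasSum_inner_krausPullback hA X x y

lemma norm_heisenberg_le (hA : IsKrausFamily A) : ‖heisenberg hA‖ ≤ 1 :=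
  LinearMap.mkContinuous_norm_le _ zero_le_one _

lemma norm_heisenberg_pow_le (hA : IsKrausFamily A) (j : ℕ) (X : K →L[ℂ] K) :
    ‖(heisenberg hA ^ j) X‖ ≤ ‖X‖ := by
  induction j with
  | zero => simp
  | succ j ih =>
    rw [pow_succ', mul_apply_eq_comp]
    exact ((heisenberg hA).le_of_opNorm_le (norm_heisenberg_le hA) _).trans (by simpa using ih)

lemma heisenberg_star (hA : IsKrausFamily A) (X : K →L[ℂ] K) :
    heisenberg hA (star X) = star (heisenberg hA X) := by
  ext y
  refine ext_inner_left ℂ fun x => ?_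
  rw [star_eq_adjoint (heisenberg hA X), ContinuousLinearMap.adjoint_inner_right,
    ← inner_conj_symm (heisenberg hA X x)]
  refine (hasSum_inner_heisenberg hA (star X) x y).unique ?_
  convert Complex.hasSum_conj'.2 ((hasSum_inner_heisenberg hA X y x)) using 1
  ext k
  rw [star_eq_adjoint, ContinuousLinearMap.adjoint_inner_right, inner_conj_symm]

/-- The commutant of the Kraus operators and their adjoints. -/
noncomputable abbrev commutant (A : κ → K →L[ℂ] K) : StarSubalgebra ℂ (K →L[ℂ] K) :=
  StarSubalgebra.centralizer ℂ (Set.range A)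

lemma mem_commutant_iff {x : K →L[ℂ] K} :
    x ∈ commutant A ↔ ∀ k, A k * x = x * A k ∧ star (A k) * x = x * star (A k) := by
  simp [commutant, StarSubalgebra.mem_centralizer_iff]

lemma commutant_apply {x : K →L[ℂ] K} (hx : x ∈ commutant A) (k : κ) (v : K) :
    A k (x v) = x (A k v) :=
  DFunLike.congr_fun ((mem_commutant_iff.1 hx k).1) v

lemma commutant_adjoint_apply {x : K →L[ℂ] K} (hx : x ∈ commutant A) (k : κ) (v : K) :
    adjoint (A k) (x v) = x (adjoint (A k) v) :=
  DFunLike.congr_fun ((mem_commutant_iff.1 hx k).2) v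

lemma heisenberg_mul_mul (hA : IsKrausFamily A) {x y : K →L[ℂ] K} (hx : x ∈ commutant A)
    (hy : y ∈ commutant A) (X : K →L[ℂ] K) :
    heisenberg hA (x * X * y) = x * heisenberg hA X * y := by
  ext v
  refine ext_inner_left ℂ fun w => ?_
  refine (hasSum_inner_heisenberg hA (x * X * y) w v).unique ?_
  simp only [mul_apply_eq_comp]
  rw [← ContinuousLinearMap.adjoint_inner_left]
  convert hasSum_inner_heisenberg hA X (adjoint x w) (y v) using 1
  ext k
  rw [commutant_apply hy, ← star_eq_adjoint x, commutant_apply (star_mem hx), star_eq_adjoint,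
    ContinuousLinearMap.adjoint_inner_left]

lemma heisenberg_pow_star (hA : IsKrausFamily A) (j : ℕ) (X : K →L[ℂ] K) :
    (heisenberg hA ^ j) (star X) = star ((heisenberg hA ^ j) X) := by
  induction j with
  | zero => simp
  | succ j ih => rw [pow_succ', mul_apply_eq_comp, mul_apply_eq_comp, ih, heisenberg_star]

lemma heisenberg_pow_mul_mul (hA : IsKrausFamily A) {x y : K →L[ℂ] K} (hx : x ∈ commutant A)
    (hy : y ∈ commutant A) (j : ℕ) (X : K →L[ℂ] K) :
    (heisenberg hA ^ j) (x * X * y) = x * (heisenberg hA ^ j) X * y := by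
  induction j with
  | zero => simp
  | succ j ih => rw [pow_succ', mul_apply_eq_comp, mul_apply_eq_comp, ih,
      heisenberg_mul_mul hA hx hy]

end Heisenberg

/-! ### Normal states -/

section NormalState

/-- A normal state of the bounded operators on `K`, given by square summable vectors `vec i` with
total squared norm `1`; see `NormalState.expect`. -/
structure NormalState (K : Type*) [NormedAddCommGroup K] where
  /-- the index set of the vectors -/
  idx : Set K
  /-- the vectors -/
  vec : idx → K
  hasSum_norm_sq : HasSum (fun i => ‖vec i‖ ^ 2) 1

variable {K : Type*} [NormedAddCommGroup K] [InnerProductSpace ℂ K]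

lemma NormalState.norm_inner_le (s : NormalState K) (X : K →L[ℂ] K) (i : s.idx) :
    ‖inner ℂ (s.vec i) (X (s.vec i))‖ ≤ ‖X‖ * ‖s.vec i‖ ^ 2 := by
  refine (norm_inner_le_norm _ _).trans ?_
  calc _ ≤ ‖s.vec i‖ * (‖X‖ * ‖s.vec i‖) := by gcongr; exact X.le_opNorm _
    _ = _ := by ring

lemma NormalState.summable (s : NormalState K) (X : K →L[ℂ] K) :
    Summable (fun i => inner ℂ (s.vec i) (X (s.vec i))) :=
  Summable.of_norm_bounded (s.hasSum_norm_sq.summable.mul_left ‖X‖) (s.norm_inner_le X)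

/-- The expectation value `∑ i, ⟪vec i, X (vec i)⟫` of `X` in the normal state. -/
noncomputable def NormalState.expect (s : NormalState K) : (K →L[ℂ] K) →ₗ[ℂ] ℂ where
  toFun X := ∑' i, inner ℂ (s.vec i) (X (s.vec i))
  map_add' X Y := by
    simp only [_root_.add_apply, inner_add_right]
    exact (s.summable X).tsum_add (s.summable Y)
  map_smul' c X := by
    simp only [_root_.smul_apply, inner_smul_right, tsum_mul_left, RingHom.id_apply,
      smul_eq_mul]

lemma NormalState.hasSum_expect (s : NormalState K) (X : K →L[ℂ] K) :
    HasSum (fun i => inner ℂ (s.vec i) (X (s.vec i))) (s.expect X) :=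
  (s.summable X).hasSum

lemma NormalState.expect_star_mul [CompleteSpace K] (s : NormalState K) (Y : K →L[ℂ] K) :
    HasSum (fun i => ‖Y (s.vec i)‖ ^ 2) (s.expect (star Y * Y)).re ∧
      ((s.expect (star Y * Y)).re : ℂ) = s.expect (star Y * Y) := by
  have h := s.hasSum_expect (star Y * Y)
  have h1 : (fun i => inner ℂ (s.vec i) ((star Y * Y) (s.vec i))) =
      fun i => ((‖Y (s.vec i)‖ ^ 2 : ℝ) : ℂ) := by
    ext i
    rw [mul_apply_eq_comp, star_eq_adjoint, ContinuousLinearMap.adjoint_inner_right,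
      inner_self_eq_norm_sq_to_K]
    norm_cast
  rw [h1] at h
  have h2 := Complex.hasSum_re h
  simp only [Complex.ofReal_re] at h2
  exact ⟨h2, (Complex.hasSum_ofReal.2 h2).unique h⟩

lemma NormalState.expect_rankOne_self (s : NormalState K) (u : K) :
    HasSum (fun i => ‖inner ℂ u (s.vec i)‖ ^ 2) (s.expect (rankOne ℂ u u)).re ∧
      ((s.expect (rankOne ℂ u u)).re : ℂ) = s.expect (rankOne ℂ u u) := by
  have h := s.hasSum_expect (rankOne ℂ u u)
  have h1 : (fun i => inner ℂ (s.vec i) (rankOne ℂ u u (s.vec i))) =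
      fun i => ((‖inner ℂ u (s.vec i)‖ ^ 2 : ℝ) : ℂ) := by
    ext i
    rw [rankOne_apply, inner_smul_right, ← inner_conj_symm (s.vec i) u, RCLike.mul_conj]
    norm_cast
  rw [h1] at h
  have h2 := Complex.hasSum_re h
  simp only [Complex.ofReal_re] at h2
  exact ⟨h2, (Complex.hasSum_ofReal.2 h2).unique h⟩

/-- The state `s` is `X ↦ tr (ρ X)`. It suffices to test rank one operators. -/
def NormalState.Represents (s : NormalState K) (ρ : K →L[ℂ] K) : Prop :=
  ∀ x y, s.expect (rankOne ℂ y x) = inner ℂ x (ρ y)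

variable [CompleteSpace K] {κ : Type*} {A : κ → K →L[ℂ] K}

lemma NormalState.Represents.apply_eq_zero {s : NormalState K} {ρ : K →L[ℂ] K}
    (h : s.Represents ρ) {X : K →L[ℂ] K} (hX : ∀ i, X (s.vec i) = 0) (y : K) : X (ρ y) = 0 := by
  refine ext_inner_left ℂ fun x => ?_
  rw [inner_zero_right, ← ContinuousLinearMap.adjoint_inner_left, ← h]
  refine (s.hasSum_expect _).unique ?_
  convert hasSum_zero using 2 with i
  rw [rankOne_apply, inner_smul_right, ContinuousLinearMap.adjoint_inner_left, hX,
    inner_zero_right, zero_mul]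

/-- An invariant density operator represents a normal state invariant in the Heisenberg picture.
For `X = Y ^ 2` and `ρ = S ^ 2` both sides are sums of squared Hilbert–Schmidt norms, of `Y A k S`
and of `Y S`, and passing to the adjoints turns the former into `tr (Y (∑ A k ρ A k†) Y)`. -/
theorem exists_normalState (hA : IsKrausFamily A) {ρ : K →L[ℂ] K} (hρ : IsDensityOperator ρ)
    (hinv : Preserves A ρ) : ∃ s : NormalState K, s.Represents ρ ∧
      ∀ X, s.expect (heisenberg hA X) = s.expect X := by
  obtain ⟨S, hS, hSρ⟩ := exists_sqrt hρ.isPositive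
  obtain ⟨w, ⟨b⟩⟩ := exists_basis K
  let s : NormalState K := ⟨w, fun i => S (b i), hρ.hasSum_sqrt hS hSρ b⟩
  refine ⟨s, ?_, ?_⟩
  · intro x y
    rw [inner_sqrt hS hSρ]
    have e : ∀ i : w, inner ℂ (s.vec i) (rankOne ℂ y x (s.vec i)) =
        inner ℂ (S x) (b i) * inner ℂ (b i) (S y) := by
      intro i
      change inner ℂ (S (b i)) (rankOne ℂ y x (S (b i))) = _
      have hs : ∀ u v, inner ℂ (S u) v = inner ℂ u (S v) := fun u v => by
        rw [← ContinuousLinearMap.adjoint_inner_right, hS]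
      rw [rankOne_apply, inner_smul_right, hs (b i) y, hs x (b i)]
    refine (s.hasSum_expect _).unique ?_
    simp only [e]
    exact b.hasSum_inner_mul_inner (S x) (S y)
  · suffices hpos : ∀ X : K →L[ℂ] K, 0 ≤ X → s.expect (heisenberg hA X) = s.expect X by
      intro X
      have hX : X ∈ Submodule.span ℂ {a : K →L[ℂ] K | 0 ≤ a} := by
        rw [CStarAlgebra.span_nonneg]; trivial
      induction hX using Submodule.span_induction with
      | mem x h => exact hpos x h
      | zero => simp
      | add x y _ _ hx hy => rw [map_add, map_add, map_add, hx, hy]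
      | smul c x _ hx => rw [map_smul, map_smul, map_smul, hx]
    intro X hX
    obtain ⟨Y, hY, hYX⟩ := exists_sqrt ((nonneg_iff_isPositive X).1 hX)
    have hX' : X = star Y * Y := by rw [star_eq_adjoint, hY, mul_def, hYX]
    have key : ∀ i : w, HasSum (fun k => ‖Y (A k (S (b i)))‖ ^ 2)
        (inner ℂ (S (b i)) (heisenberg hA X (S (b i)))).re := by
      intro i
      have h := Complex.hasSum_re (hasSum_inner_heisenberg hA X (S (b i)) (S (b i)))
      simpa only [inner_sqrt_self hY hYX, Complex.ofReal_re] using h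
    have key' : ∀ i : w, ((inner ℂ (S (b i)) (heisenberg hA X (S (b i)))).re : ℂ) =
        inner ℂ (S (b i)) (heisenberg hA X (S (b i))) := by
      intro i
      refine (Complex.hasSum_ofReal.2 (key i)).unique ?_
      simpa only [inner_sqrt_self hY hYX] using
        hasSum_inner_heisenberg hA X (S (b i)) (S (b i))
    have hkraus : ∀ v, HasSum (fun k => ‖S (adjoint (A k) v)‖ ^ 2) (‖S v‖ ^ 2) := by
      intro v
      have h := hasSum_inner_left (hinv v) v
      refine Complex.hasSum_ofReal.1 ?_
      convert h using 1
      · ext k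
        rw [ContinuousLinearMap.comp_apply, ContinuousLinearMap.comp_apply,
          ← ContinuousLinearMap.adjoint_inner_left, inner_sqrt_self hS hSρ]
      · rw [inner_sqrt_self hS hSρ]
    have hsum : ∑' i : w, ∑' k, ‖Y (A k (S (b i)))‖ₑ ^ 2 = ∑' i : w, ‖Y (S (b i))‖ₑ ^ 2 := by
      rw [ENNReal.tsum_comm]
      have h1 : ∀ k, ∑' i : w, ‖Y (A k (S (b i)))‖ₑ ^ 2 =
          ∑' i : w, ‖S (adjoint (A k) (Y (b i)))‖ₑ ^ 2 := by
        intro k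
        have := tsum_enorm_sq_adjoint b b (Y ∘L A k ∘L S)
        simpa only [adjoint_comp, hS, hY, ContinuousLinearMap.comp_apply] using this
      have h2 := tsum_enorm_sq_adjoint b b (Y ∘L S)
      simp only [adjoint_comp, hS, hY, ContinuousLinearMap.comp_apply] at h2
      rw [tsum_congr h1, h2, ENNReal.tsum_comm]
      refine tsum_congr fun i => ?_
      rw [(hasSum_norm_sq_iff (by positivity)).1 (hkraus (Y (b i))), ofReal_norm_sq]
    have hsq := s.expect_star_mul Y
    rw [← hX'] at hsq
    have hnn : ∀ i : w, 0 ≤ (inner ℂ (S (b i)) (heisenberg hA X (S (b i)))).re :=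
      fun i => (key i).nonneg (fun _ => by positivity)
    have hfin : HasSum (fun i : w => (inner ℂ (S (b i)) (heisenberg hA X (S (b i)))).re)
        (s.expect X).re := by
      refine hasSum_of_tsum_ofReal hnn (hsq.1.nonneg fun _ => by positivity) ?_
      rw [← (hasSum_norm_sq_iff (hsq.1.nonneg fun _ => by positivity)).1 hsq.1]
      refine Eq.trans (tsum_congr fun i => ?_) hsum
      rw [(hasSum_norm_sq_iff (hnn i)).1 (key i)]
    refine (s.hasSum_expect _).unique ?_
    rw [← hsq.2]
    have := Complex.hasSum_ofReal.2 hfin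
    convert this using 1
    ext i
    exact (key' i).symm

end NormalState

/-! ### The conditional expectation onto the commutant -/

section Expectation

variable {K : Type*} [NormedAddCommGroup K] [InnerProductSpace ℂ K] [CompleteSpace K]
  {κ : Type*} {A : κ → K →L[ℂ] K}

/-- The bounded sequence `⟪x, Φ^j X y⟫` of matrix elements along the Heisenberg evolution `Φ`. -/
noncomputable def orbitSeq (hA : IsKrausFamily A) (X : K →L[ℂ] K) (x y : K) : ℕ →ᵇ ℂ :=
  BoundedContinuousFunction.ofNormedAddCommGroupDiscrete
    (fun j => inner ℂ x ((heisenberg hA ^ j) X y)) (‖X‖ * ‖x‖ * ‖y‖) (fun j => by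
      refine (norm_inner_le_norm _ _).trans ?_
      calc _ ≤ ‖x‖ * (‖X‖ * ‖y‖) := by
            gcongr
            exact ContinuousLinearMap.le_of_opNorm_le _ (norm_heisenberg_pow_le hA j X) y
        _ = _ := by ring)

lemma orbitSeq_apply (hA : IsKrausFamily A) (X : K →L[ℂ] K) (x y : K) (j : ℕ) :
    orbitSeq hA X x y j = inner ℂ x ((heisenberg hA ^ j) X y) := rfl

lemma norm_orbitSeq_le (hA : IsKrausFamily A) (X : K →L[ℂ] K) (x y : K) :
    ‖orbitSeq hA X x y‖ ≤ ‖X‖ * ‖x‖ * ‖y‖ :=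
  (BoundedContinuousFunction.norm_le (by positivity)).2 fun j => by
    rw [orbitSeq_apply]
    refine (norm_inner_le_norm _ _).trans ?_
    calc _ ≤ ‖x‖ * (‖X‖ * ‖y‖) := by
          gcongr
          exact ContinuousLinearMap.le_of_opNorm_le _ (norm_heisenberg_pow_le hA j X) y
      _ = _ := by ring

/-- A bounded sesquilinear form is represented by a bounded operator. -/
lemma exists_operator_of_form (B : K → K → ℂ) (C : ℝ)
    (h1 : ∀ x x' y, B (x + x') y = B x y + B x' y)
    (h2 : ∀ (c : ℂ) x y, B (c • x) y = star c * B x y)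
    (h3 : ∀ x y y', B x (y + y') = B x y + B x y')
    (h4 : ∀ (c : ℂ) x y, B x (c • y) = c * B x y)
    (hB : ∀ x y, ‖B x y‖ ≤ C * ‖x‖ * ‖y‖) :
    ∃ T : K →L[ℂ] K, ∀ x y, inner ℂ x (T y) = B x y := by
  let F : K →L⋆[ℂ] K →L[ℂ] ℂ := LinearMap.mkContinuous₂
    (LinearMap.mk₂'ₛₗ (starRingEnd ℂ) (RingHom.id ℂ) B h1 h2 h3 h4) C hB
  refine ⟨adjoint (InnerProductSpace.continuousLinearMapOfBilin F), fun x y => ?_⟩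
  rw [ContinuousLinearMap.adjoint_inner_right,
    InnerProductSpace.continuousLinearMapOfBilin_apply]
  rfl

/-- Averaging the Heisenberg evolution with a Banach limit gives a contraction into its fixed
points, which is a bimodule map over the commutant and preserves every invariant normal
state. -/
theorem exists_average (hA : IsKrausFamily A) : ∃ E : (K →L[ℂ] K) →ₗ[ℂ] (K →L[ℂ] K),
    (∀ X, heisenberg hA (E X) = E X) ∧ (∀ X, ‖E X‖ ≤ ‖X‖) ∧ (∀ X, E (star X) = star (E X)) ∧
    (∀ x ∈ commutant A, ∀ y ∈ commutant A, ∀ X, E (x * X * y) = x * E X * y) ∧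
    (∀ s : NormalState K, (∀ X, s.expect (heisenberg hA X) = s.expect X) →
      ∀ X, s.expect (E X) = s.expect X) := by
  obtain ⟨M⟩ := exists_banachLimit
  have hex : ∀ X : K →L[ℂ] K, ∃ T : K →L[ℂ] K, ∀ x y,
      inner ℂ x (T y) = M.toCLM (orbitSeq hA X x y) := by
    intro X
    refine exists_operator_of_form _ ‖X‖ ?_ ?_ ?_ ?_ ?_
    · intro x x' y
      rw [← map_add]
      congr 1
      ext j
      simp [orbitSeq_apply]
    · intro c x y
      rw [← smul_eq_mul, ← map_smul]
      congr 1
      ext j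
      simp [orbitSeq_apply]
      ring
    · intro x y y'
      rw [← map_add]
      congr 1
      ext j
      simp [orbitSeq_apply]
    · intro c x y
      rw [← smul_eq_mul, ← map_smul]
      congr 1
      ext j
      simp [orbitSeq_apply]
    · intro x y
      exact (M.norm_le _).trans (norm_orbitSeq_le hA X x y)
  choose E hE using hex
  have hext : ∀ {S T : K →L[ℂ] K}, (∀ x y, inner ℂ x (S y) = inner ℂ x (T y)) → S = T :=
    fun h => ContinuousLinearMap.ext fun y => ext_inner_left ℂ fun x => h x y
  refine ⟨⟨⟨E, ?_⟩, ?_⟩, ?_, ?_, ?_, ?_, ?_⟩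
  · intro X Y
    refine hext fun x y => ?_
    rw [_root_.add_apply, inner_add_right, hE, hE, hE, ← map_add]
    congr 1
    ext j
    simp [orbitSeq_apply]
  · intro c X
    refine hext fun x y => ?_
    rw [RingHom.id_apply, _root_.smul_apply, inner_smul_right, hE, hE, ← smul_eq_mul, ← map_smul]
    congr 1
    ext j
    simp [orbitSeq_apply]
  · intro X
    refine hext fun x y => ?_
    change _ = inner ℂ x (E X y)
    refine (hasSum_inner_heisenberg hA (E X) x y).unique ?_
    simp only [hE]
    -- both sides average the sequence `⟪x, Φ^(j+1) X y⟫`, up to a shift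
    let w : ℕ →ᵇ ℂ := orbitSeq hA (heisenberg hA X) x y
    have hw : ∀ n, w n = orbitSeq hA X x y (n + 1) := by
      intro n
      change inner ℂ x ((heisenberg hA ^ n) (heisenberg hA X) y) = _
      rw [orbitSeq_apply, pow_succ, mul_apply_eq_comp]
    rw [← M.shift _ w hw]
    have hcs : Summable fun k => ‖X‖ * ((‖A k x‖ ^ 2 + ‖A k y‖ ^ 2) / 2) :=
      (((hA.hasSum_norm_sq x).summable.add (hA.hasSum_norm_sq y).summable).div_const 2).mul_left _
    refine M.hasSum _ _ _ hcs ?_ ?_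
    · intro k n
      refine ((orbitSeq hA X (A k x) (A k y)).norm_coe_le_norm n).trans
        ((norm_orbitSeq_le hA X _ _).trans ?_)
      rw [mul_assoc]
      gcongr
      nlinarith [sq_nonneg (‖A k x‖ - ‖A k y‖)]
    · intro n
      rw [hw, orbitSeq_apply, pow_succ', mul_apply_eq_comp]
      exact hasSum_inner_heisenberg hA _ x y
  · intro X
    refine ContinuousLinearMap.opNorm_le_bound _ (norm_nonneg _) fun y => ?_
    change ‖E X y‖ ≤ _
    rcases eq_or_ne (E X y) 0 with h0 | h0
    · rw [h0, norm_zero]; positivity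
    · have h : ‖inner ℂ (E X y) (E X y)‖ ≤ ‖X‖ * ‖E X y‖ * ‖y‖ := by
        rw [hE]
        exact (M.norm_le _).trans (norm_orbitSeq_le hA X _ _)
      rw [inner_self_eq_norm_sq_to_K, norm_pow, RCLike.norm_ofReal, abs_norm] at h
      have : 0 < ‖E X y‖ := norm_pos_iff.2 h0
      nlinarith
  · intro X
    refine hext fun x y => ?_
    change inner ℂ x (E (star X) y) = inner ℂ x (star (E X) y)
    rw [hE, star_eq_adjoint (E X), ContinuousLinearMap.adjoint_inner_right, ← inner_conj_symm, hE]
    change _ = star _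
    rw [← M.conj]
    congr 1
    ext j
    simp only [orbitSeq_apply, BoundedContinuousFunction.star_apply, heisenberg_pow_star]
    rw [star_eq_adjoint, ContinuousLinearMap.adjoint_inner_right]
    exact (inner_conj_symm _ _).symm
  · intro x hx y hy X
    refine hext fun v w => ?_
    change inner ℂ v (E (x * X * y) w) = inner ℂ v ((x * E X * y) w)
    rw [mul_apply_eq_comp, mul_apply_eq_comp, ← ContinuousLinearMap.adjoint_inner_left x, hE, hE]
    congr 1
    ext j
    rw [orbitSeq_apply, orbitSeq_apply, heisenberg_pow_mul_mul hA hx hy, mul_apply_eq_comp,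
      mul_apply_eq_comp, ContinuousLinearMap.adjoint_inner_left]
  · intro s hs X
    change s.expect (E X) = _
    refine (s.hasSum_expect _).unique ?_
    simp only [hE]
    have hpow : ∀ j, s.expect ((heisenberg hA ^ j) X) = s.expect X := by
      intro j
      induction j with
      | zero => simp
      | succ j ih => rw [pow_succ', mul_apply_eq_comp, hs, ih]
    let w : ℕ →ᵇ ℂ := BoundedContinuousFunction.const ℕ (s.expect X)
    rw [← M.const (s.expect X) w (fun n => rfl)]
    refine M.hasSum _ _ _ (s.hasSum_norm_sq.summable.mul_left ‖X‖) ?_ ?_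
    · intro i n
      refine ((orbitSeq hA X _ _).norm_coe_le_norm n).trans
        ((norm_orbitSeq_le hA X _ _).trans_eq ?_)
      ring
    · intro n
      change HasSum _ (s.expect X)
      rw [← hpow n]
      exact s.hasSum_expect _

/-- A fixed point of the Heisenberg evolution commutes with the Kraus operators on the vectors of
every invariant normal state: the squared norms of the commutators sum to
`s (Φ (Y† Y)) - s (Y† Y) = 0`. -/
lemma commute_of_heisenberg_fixed (hA : IsKrausFamily A) {Y : K →L[ℂ] K}
    (hY : heisenberg hA Y = Y) {s : NormalState K}
    (hs : ∀ X, s.expect (heisenberg hA X) = s.expect X) (k : κ) (i : s.idx) :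
    A k (Y (s.vec i)) = Y (A k (s.vec i)) := by
  -- the sum over `k` of `(Y A k - A k Y)† (Y A k - A k Y)` is `Φ (Y† Y) - Y† Y`
  have hY' : heisenberg hA (star Y) = star Y := by rw [heisenberg_star, hY]
  have key : ∀ v, HasSum (fun k => ‖Y (A k v) - A k (Y v)‖ ^ 2)
      ((inner ℂ v (heisenberg hA (star Y * Y) v)).re - (inner ℂ v ((star Y * Y) v)).re) := by
    intro v
    have e1 := hasSum_inner_heisenberg hA (star Y * Y) v v
    have e2 := hasSum_inner_heisenberg hA (star Y) v (Y v)
    have e3 := hasSum_inner_heisenberg hA Y (Y v) v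
    have e4 := Complex.hasSum_ofReal.2 (hA.hasSum_norm_sq (Y v))
    have h := Complex.hasSum_re (((e1.sub e2).sub e3).add e4)
    rw [hY, hY'] at h
    convert h using 1
    · ext k
      rw [mul_apply_eq_comp, star_eq_adjoint, ContinuousLinearMap.adjoint_inner_right,
        ContinuousLinearMap.adjoint_inner_right, @norm_sub_sq ℂ]
      rw [inner_self_ofReal, ← inner_conj_symm (A k (Y v)) (Y (A k v))]
      simp only [Complex.add_re, Complex.sub_re, Complex.ofReal_re, Complex.conj_re,
        RCLike.re_to_complex]
      ring
    · rw [mul_apply_eq_comp, star_eq_adjoint, ContinuousLinearMap.adjoint_inner_right,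
        inner_self_ofReal]
      simp only [Complex.add_re, Complex.sub_re, Complex.ofReal_re]
      ring
  have hnn : ∀ i, 0 ≤ (inner ℂ (s.vec i) (heisenberg hA (star Y * Y) (s.vec i))).re -
      (inner ℂ (s.vec i) ((star Y * Y) (s.vec i))).re :=
    fun i => (key _).nonneg fun _ => by positivity
  have hsum := (Complex.hasSum_re (s.hasSum_expect (heisenberg hA (star Y * Y)))).sub
    (Complex.hasSum_re (s.hasSum_expect (star Y * Y)))
  rw [hs, sub_self] at hsum
  have hz := (hasSum_zero_iff_of_nonneg hnn).1 hsum
  have hzi := congrFun hz i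
  have hk := key (s.vec i)
  simp only [Pi.zero_apply] at hzi
  rw [hzi] at hk
  have := congrFun ((hasSum_zero_iff_of_nonneg (fun _ => by positivity)).1 hk) k
  simp only [Pi.zero_apply, ne_eq, OfNat.ofNat_ne_zero, not_false_eq_true, pow_eq_zero_iff,
    norm_eq_zero] at this
  exact (sub_eq_zero.1 this).symm

/-- A contractive bimodule map from the bounded operators to the commutant of the Kraus operators
that preserves the given normal states. -/
structure ConditionalExpectation (A : κ → K →L[ℂ] K) {T : Type*} (s : T → NormalState K) where
  /-- the underlying map -/
  toLin : (K →L[ℂ] K) →ₗ[ℂ] (K →L[ℂ] K)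
  mem : ∀ X, toLin X ∈ commutant A
  norm_le : ∀ X, ‖toLin X‖ ≤ ‖X‖
  map_star : ∀ X, toLin (star X) = star (toLin X)
  bimodule : ∀ x ∈ commutant A, ∀ y ∈ commutant A, ∀ X, toLin (x * X * y) = x * toLin X * y
  expect : ∀ t X, (s t).expect (toLin X) = (s t).expect X

/-- When the invariant normal states are jointly faithful, the fixed points of the Heisenberg
evolution commute with the Kraus operators, so that averaging maps into the commutant. -/
theorem exists_conditionalExpectation (hA : IsKrausFamily A) {T : Type*} {s : T → NormalState K}
    (hs : ∀ t X, (s t).expect (heisenberg hA X) = (s t).expect X)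
    (hfaith : ∀ X : K →L[ℂ] K, (∀ t i, X ((s t).vec i) = 0) → X = 0) :
    Nonempty (ConditionalExpectation A s) := by
  obtain ⟨E, hfix, hnorm, hstar, hbi, hexp⟩ := exists_average hA
  have hcomm : ∀ Y, heisenberg hA Y = Y → ∀ k, A k * Y = Y * A k := by
    intro Y hY k
    refine sub_eq_zero.1 (hfaith _ fun t i => ?_)
    rw [_root_.sub_apply, mul_apply_eq_comp, mul_apply_eq_comp, sub_eq_zero]
    exact commute_of_heisenberg_fixed hA hY (hs t) k i
  refine ⟨⟨E, fun X => ?_, hnorm, hstar, hbi, fun t => hexp (s t) (hs t)⟩⟩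
  rw [mem_commutant_iff]
  intro k
  refine ⟨hcomm _ (hfix X) k, ?_⟩
  have h := congrArg star (hcomm _ (hfix (star X)) k)
  rw [star_mul, star_mul, hstar, star_star] at h
  exact h.symm

end Expectation

/-! ### Projections in the commutant -/

section Projections

variable {K : Type*} [NormedAddCommGroup K] [InnerProductSpace ℂ K] [CompleteSpace K]
  {κ : Type*} {A : κ → K →L[ℂ] K}

lemma starProjection_mem_commutant (V : Submodule ℂ K) [V.HasOrthogonalProjection]
    (h1 : ∀ k, ∀ v ∈ V, A k v ∈ V) (h2 : ∀ k, ∀ v ∈ V, adjoint (A k) v ∈ V) :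
    V.starProjection ∈ commutant A := by
  have hP : star V.starProjection = V.starProjection :=
    (isStarProjection_starProjection (U := V)).isSelfAdjoint
  have e1 : ∀ k, V.starProjection * (A k * V.starProjection) = A k * V.starProjection := fun k =>
    ContinuousLinearMap.ext fun v => Submodule.starProjection_eq_self_iff.2
      (h1 k _ (Submodule.starProjection_apply_mem _ _))
  have e2 : ∀ k, V.starProjection * (star (A k) * V.starProjection) =
      star (A k) * V.starProjection := fun k =>
    ContinuousLinearMap.ext fun v => Submodule.starProjection_eq_self_iff.2
      (h2 k _ (Submodule.starProjection_apply_mem _ _))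
  rw [mem_commutant_iff]
  intro k
  constructor
  · have := congrArg star (e2 k)
    simp only [star_mul, star_star, hP] at this
    rw [← e1, ← mul_assoc, this]
  · have := congrArg star (e1 k)
    simp only [star_mul, hP] at this
    rw [← e2, ← mul_assoc, this]

/-- The projection onto the closed range of an operator in the commutant. -/
lemma exists_support {g : K →L[ℂ] K} (hg : g ∈ commutant A) :
    ∃ p ∈ commutant A, IsStarProjection p ∧ p * g = g ∧
      (∀ x : K →L[ℂ] K, x * g = 0 → x * p = 0) ∧
      ∀ v, p v ∈ closure (Set.range g) := by
  let V : Submodule ℂ K := (LinearMap.range (g : K →ₗ[ℂ] K)).topologicalClosure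
  have hVc : IsClosed (V : Set K) := Submodule.isClosed_topologicalClosure _
  have : CompleteSpace V := hVc.completeSpace_coe
  have hgV : ∀ v, g v ∈ V := fun v => Submodule.le_topologicalClosure _ ⟨v, rfl⟩
  have hV : (V : Set K) = closure (Set.range g) := by
    rw [Submodule.topologicalClosure_coe]
    rfl
  have hmap : ∀ (a : K →L[ℂ] K), (∀ v, a (g v) = g (a v)) → ∀ v ∈ V, a v ∈ V := by
    intro a ha v hv
    have hv' : v ∈ closure (Set.range g) := hV ▸ hv
    have h : a v ∈ closure (V : Set K) := map_mem_closure a.continuous hv' ?_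
    · rwa [hVc.closure_eq] at h
    rintro _ ⟨w, rfl⟩
    rw [ha]
    exact hgV _
  refine ⟨V.starProjection, starProjection_mem_commutant V
    (fun k => hmap _ (commutant_apply hg k)) (fun k => hmap _ (commutant_adjoint_apply hg k)),
    isStarProjection_starProjection, ?_, ?_, ?_⟩
  · ext v
    exact Submodule.starProjection_eq_self_iff.2 (hgV v)
  · intro x hx
    ext v
    have h1 : V.starProjection v ∈ closure (Set.range g) :=
      hV ▸ Submodule.starProjection_apply_mem _ _
    have h2 : Set.EqOn x (0 : K →L[ℂ] K) (Set.range g) := by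
      rintro _ ⟨w, rfl⟩
      exact DFunLike.congr_fun hx w
    exact h2.closure x.continuous continuous_const h1
  · intro v
    exact hV ▸ Submodule.starProjection_apply_mem V v

/-- A minimal nonzero projection of the commutant: the projection onto an irreducible reducing
subspace of the Kraus operators. -/
structure IsIrreducibleProj (A : κ → K →L[ℂ] K) (p : K →L[ℂ] K) : Prop where
  mem : p ∈ commutant A
  isStarProjection : IsStarProjection p
  ne_zero : p ≠ 0
  minimal : ∀ q ∈ commutant A, IsStarProjection q → p * q = q → q = 0 ∨ q = p

lemma mul_posPart_eq (a : K →L[ℂ] K) (ha : IsSelfAdjoint a) : a * a⁺ = a⁺ * a⁺ := by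
  nth_rw 1 [← CFC.posPart_sub_negPart a ha]
  rw [sub_mul, CFC.negPart_mul_posPart, sub_zero]

lemma commute_posPart {a b : K →L[ℂ] K} (h : Commute a b) : Commute a⁺ b := by
  rw [CFC.posPart_def]
  exact h.cfcₙ_real _

lemma posPart_mem_commutant {a : K →L[ℂ] K} (ha : a ∈ commutant A) : a⁺ ∈ commutant A := by
  rw [mem_commutant_iff] at ha ⊢
  exact fun k => ⟨(commute_posPart (ha k).1.symm).symm, (commute_posPart (ha k).2.symm).symm⟩

lemma mul_posPart_eq_zero {a x : K →L[ℂ] K} (ha : IsSelfAdjoint a) (h : x * a = 0) :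
    x * a⁺ = 0 := by
  have hs : star (a⁺ : K →L[ℂ] K) = a⁺ := (CFC.posPart_nonneg a).isSelfAdjoint
  rw [← CStarRing.mul_star_self_eq_zero_iff, star_mul, hs, mul_assoc, ← mul_assoc a⁺,
    ← mul_posPart_eq a ha, ← mul_assoc, ← mul_assoc, h, zero_mul, zero_mul]

lemma one_sub_mul_eq_zero {R : Type*} [Ring R] {p x : R} : (1 - p) * x = 0 ↔ p * x = x := by
  rw [sub_mul, one_mul, sub_eq_zero, eq_comm]

lemma mul_one_sub_eq_zero {R : Type*} [Ring R] {p x : R} : x * (1 - p) = 0 ↔ x * p = x := by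
  rw [mul_sub, mul_one, sub_eq_zero, eq_comm]

lemma mul_eq_self_of_star {p x : K →L[ℂ] K} (hp : IsStarProjection p) (hx : star x = x)
    (h : p * x = x) : x * p = x := by
  have := congrArg star h
  rwa [star_mul, hx, hp.isSelfAdjoint.star_eq] at this

/-- A nonnegative element of the corner of an irreducible projection with a vanishing expectation
value is zero: its support cannot be all of the irreducible subspace. -/
lemma IsIrreducibleProj.eq_zero_of_nonneg {p b : K →L[ℂ] K} (hp : IsIrreducibleProj A p)
    (hb : b ∈ commutant A) (hb0 : 0 ≤ b) (hpb : p * b = b) {v : K} (hv : p v = v) (hv0 : v ≠ 0)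
    (hbv : inner ℂ v (b v) = 0) : b = 0 := by
  obtain ⟨Y, hY, hYb⟩ := exists_sqrt ((nonneg_iff_isPositive b).1 hb0)
  have hbv' : b v = 0 := by
    rw [inner_sqrt_self hY hYb] at hbv
    have : Y v = 0 := by simpa using hbv
    rw [← hYb, ContinuousLinearMap.comp_apply, this, map_zero]
  obtain ⟨r, hr, hrp, hrb, hrx, -⟩ := exists_support hb
  have hpr : p * r = r := one_sub_mul_eq_zero.1 (hrx _ (one_sub_mul_eq_zero.2 hpb))
  rcases hp.minimal r hr hrp hpr with h | h
  · rw [← hrb, h, zero_mul]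
  · exfalso
    have h1 : rankOne ℂ v v * b = 0 := by
      ext w
      have : inner ℂ v (b w) = 0 := by
        rw [← hYb, ContinuousLinearMap.comp_apply, ← ContinuousLinearMap.adjoint_inner_left,
          ← ContinuousLinearMap.adjoint_inner_left, hY, ← ContinuousLinearMap.comp_apply Y Y, hYb,
          hbv', inner_zero_left]
      simp [this]
    have h2 := DFunLike.congr_fun (hrx _ h1) v
    rw [h, mul_apply_eq_comp, hv, rankOne_apply, _root_.zero_apply, smul_eq_zero] at h2
    rcases h2 with h2 | h2
    · exact hv0 (inner_self_eq_zero.1 h2)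
    · exact hv0 h2

lemma IsIrreducibleProj.exists_unit {p : K →L[ℂ] K} (hp : IsIrreducibleProj A p) :
    ∃ v, p v = v ∧ ‖v‖ = 1 := by
  obtain ⟨w, hw⟩ : ∃ w, p w ≠ 0 := by
    by_contra! h
    exact hp.ne_zero (ContinuousLinearMap.ext h)
  refine ⟨((‖p w‖⁻¹ : ℝ) : ℂ) • p w, ?_, ?_⟩
  · rw [map_smul, ← mul_apply_eq_comp, hp.isStarProjection.isIdempotentElem.eq]
  · rw [norm_smul, Complex.norm_real, norm_inv, norm_norm, inv_mul_cancel₀ (norm_ne_zero_iff.2 hw)]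

/-- Schur's lemma for self-adjoint elements of the commutant. -/
lemma IsIrreducibleProj.exists_smul_of_isSelfAdjoint {p x : K →L[ℂ] K}
    (hp : IsIrreducibleProj A p) (hx : x ∈ commutant A) (hxs : IsSelfAdjoint x)
    (hpx : p * x = x) : ∃ β : ℝ, x = (β : ℂ) • p := by
  obtain ⟨v, hv, hv1⟩ := hp.exists_unit
  have hv0 : v ≠ 0 := by
    rintro rfl
    simp at hv1
  have hxv : ((inner ℂ v (x v)).re : ℂ) = inner ℂ v (x v) := by
    refine Complex.conj_eq_iff_re.1 ?_
    rw [inner_conj_symm, ← ContinuousLinearMap.adjoint_inner_right, ← star_eq_adjoint, hxs.star_eq]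
  refine ⟨(inner ℂ v (x v)).re, ?_⟩
  set β : ℝ := (inner ℂ v (x v)).re with hβ
  set a : K →L[ℂ] K := x - (β : ℂ) • p with hadef
  have ha : a ∈ commutant A := sub_mem hx ((commutant A).smul_mem hp.mem _)
  have has : IsSelfAdjoint a := by
    refine hxs.sub ?_
    rw [isSelfAdjoint_iff, star_smul, hp.isStarProjection.isSelfAdjoint.star_eq]
    simp
  have hpa : p * a = a := by
    rw [hadef, mul_sub, hpx, mul_smul_comm, hp.isStarProjection.isIdempotentElem.eq]
  have hav : inner ℂ v (a v) = 0 := by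
    rw [hadef, _root_.sub_apply, inner_sub_right, _root_.smul_apply, inner_smul_right, hv,
      inner_self_eq_norm_sq_to_K, hv1, hxv]
    simp
  have hzero : a⁺ = 0 ∨ a⁻ = 0 := by
    have hpos : p * a⁺ = a⁺ :=
      one_sub_mul_eq_zero.1 (mul_posPart_eq_zero has (one_sub_mul_eq_zero.2 hpa))
    have hneg : p * a⁻ = a⁻ := by
      have : a⁻ = a⁺ - a :=
        eq_sub_of_add_eq (sub_eq_iff_eq_add'.1 (CFC.posPart_sub_negPart a has)).symm
      rw [this, mul_sub, hpos, hpa]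
    obtain ⟨r, hr, hrp, hrb, hrx, -⟩ := exists_support (posPart_mem_commutant ha)
    have hpr : p * r = r := one_sub_mul_eq_zero.1 (hrx _ (one_sub_mul_eq_zero.2 hpos))
    rcases hp.minimal r hr hrp hpr with h | h
    · left
      rw [← hrb, h, zero_mul]
    · right
      have h1 := hrx _ (CFC.negPart_mul_posPart a)
      rw [h] at h1
      rwa [mul_eq_self_of_star hp.isStarProjection (CFC.negPart_nonneg a).isSelfAdjoint hneg] at h1
  have ha0 : a = 0 := by
    have hsub := CFC.posPart_sub_negPart a has
    rcases hzero with h | h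
    · rw [h, zero_sub] at hsub
      have : -a = 0 := by
        refine hp.eq_zero_of_nonneg (neg_mem ha) ?_ (by rw [mul_neg, hpa]) hv hv0 ?_
        · rw [← hsub, neg_neg]
          exact CFC.negPart_nonneg a
        · rw [_root_.neg_apply, inner_neg_right, hav, neg_zero]
      simpa using this
    · rw [h, sub_zero] at hsub
      refine hp.eq_zero_of_nonneg ha ?_ hpa hv hv0 hav
      rw [← hsub]
      exact CFC.posPart_nonneg a
  exact sub_eq_zero.1 ha0

/-- Schur's lemma: the corner of the commutant at an irreducible projection is one-dimensional. -/
theorem IsIrreducibleProj.exists_smul {p x : K →L[ℂ] K} (hp : IsIrreducibleProj A p)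
    (hx : x ∈ commutant A) (hpx : p * x = x) (hxp : x * p = x) : ∃ β : ℂ, x = β • p := by
  have hps := hp.isStarProjection.isSelfAdjoint.star_eq
  have hpx' : p * star x = star x := by
    have := congrArg star hxp
    rwa [star_mul, hps] at this
  have hxs : star x ∈ commutant A := star_mem hx
  obtain ⟨a, ha⟩ := hp.exists_smul_of_isSelfAdjoint (x := x + star x) (add_mem hx hxs)
    (IsSelfAdjoint.add_star_self x) (by rw [mul_add, hpx, hpx'])
  obtain ⟨b, hb⟩ := hp.exists_smul_of_isSelfAdjoint (x := Complex.I • (x - star x))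
    ((commutant A).smul_mem (sub_mem hx hxs) _)
    (by
      rw [isSelfAdjoint_iff, star_smul, star_sub, star_star]
      simp only [RCLike.star_def, Complex.conj_I]
      rw [neg_smul, ← smul_neg, neg_sub])
    (by rw [mul_smul_comm, mul_sub, hpx, hpx'])
  refine ⟨(1 / 2 : ℂ) * (a - Complex.I * b), ?_⟩
  have e : x = (1 / 2 : ℂ) • ((x + star x) - Complex.I • (Complex.I • (x - star x))) := by
    rw [smul_smul, Complex.I_mul_I]
    module
  rw [ha, hb] at e
  rw [e]
  module

/-- Murray–von Neumann equivalence of projections in the commutant; for projections onto reducing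
subspaces it is unitary equivalence of the restricted Kraus operators. -/
def ProjEquiv (A : κ → K →L[ℂ] K) (p q : K →L[ℂ] K) : Prop :=
  ∃ w ∈ commutant A, star w * w = p ∧ w * star w = q

lemma mul_of_star_mul_eq {p w : K →L[ℂ] K} (hp : IsStarProjection p) (h : star w * w = p) :
    w * p = w := by
  have hps := hp.isSelfAdjoint.star_eq
  have : (w * (1 - p)) = 0 := by
    rw [← CStarRing.star_mul_self_eq_zero_iff, star_mul, star_sub, hps, star_one, mul_assoc,
      ← mul_assoc (star w), h, mul_sub, mul_one, hp.isIdempotentElem.eq, sub_self, mul_zero]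
  exact mul_one_sub_eq_zero.1 this

lemma mul_of_mul_star_eq {q w : K →L[ℂ] K} (hq : IsStarProjection q) (h : w * star w = q) :
    q * w = w := by
  have := mul_of_star_mul_eq (w := star w) hq (by rwa [star_star])
  have := congrArg star this
  rwa [star_mul, star_star, hq.isSelfAdjoint.star_eq] at this

lemma ProjEquiv.refl {p : K →L[ℂ] K} (hp : IsIrreducibleProj A p) : ProjEquiv A p p :=
  ⟨p, hp.mem, by rw [hp.isStarProjection.isSelfAdjoint.star_eq,
    hp.isStarProjection.isIdempotentElem.eq], by rw [hp.isStarProjection.isSelfAdjoint.star_eq,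
    hp.isStarProjection.isIdempotentElem.eq]⟩

lemma ProjEquiv.symm {p q : K →L[ℂ] K} (h : ProjEquiv A p q) : ProjEquiv A q p := by
  obtain ⟨w, hw, h1, h2⟩ := h
  exact ⟨star w, star_mem hw, by rwa [star_star], by rwa [star_star]⟩

lemma ProjEquiv.trans {p q r : K →L[ℂ] K} (hp : IsIrreducibleProj A p)
    (hr : IsIrreducibleProj A r) (h : ProjEquiv A p q) (h' : ProjEquiv A q r) :
    ProjEquiv A p r := by
  obtain ⟨w, hw, h1, h2⟩ := h
  obtain ⟨w', hw', h1', h2'⟩ := h'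
  refine ⟨w' * w, mul_mem hw' hw, ?_, ?_⟩
  · rw [star_mul, mul_assoc, ← mul_assoc (star w'), h1', ← h2, mul_assoc, h1,
      mul_of_star_mul_eq hp.isStarProjection h1, h1]
  · rw [star_mul, mul_assoc, ← mul_assoc w, h2, ← h1', mul_assoc, h2', ← mul_assoc]
    rw [mul_assoc, ← h2']
    have := mul_of_mul_star_eq hr.isStarProjection h2'
    have := congrArg star this
    rw [star_mul, hr.isStarProjection.isSelfAdjoint.star_eq, ← h2'] at this
    rw [this]

/-- Schur's lemma for inequivalent irreducibles: a nonzero intertwiner is a multiple of a partial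
isometry. -/
theorem projEquiv_of_intertwiner {p q y : K →L[ℂ] K} (hp : IsIrreducibleProj A p)
    (hq : IsIrreducibleProj A q) (hy : y ∈ commutant A) (hqy : q * y = y) (hyp : y * p = y)
    (hy0 : y ≠ 0) : ProjEquiv A p q := by
  have hps := hp.isStarProjection.isSelfAdjoint.star_eq
  have hpy : p * star y = star y := by
    have := congrArg star hyp
    rwa [star_mul, hps] at this
  have hys : star y ∈ commutant A := star_mem hy
  obtain ⟨β, hβ⟩ := hp.exists_smul_of_isSelfAdjoint (mul_mem hys hy)
    (IsSelfAdjoint.star_mul_self y) (by rw [← mul_assoc, hpy])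
  obtain ⟨β', hβ'⟩ := hq.exists_smul_of_isSelfAdjoint (mul_mem hy hys)
    (IsSelfAdjoint.mul_star_self y) (by rw [← mul_assoc, hqy])
  have hββ' : β = β' := by
    have h1 : (β : ℂ) • y = (β' : ℂ) • y := by
      calc (β : ℂ) • y = y * (star y * y) := by rw [hβ, mul_smul_comm, hyp]
        _ = (β' : ℂ) • y := by rw [← mul_assoc, hβ', smul_mul_assoc, hqy]
    exact_mod_cast smul_left_injective ℂ hy0 h1
  have hβpos : 0 < β := by
    obtain ⟨v, hv, hv1⟩ := hp.exists_unit
    have h1 : inner ℂ v ((star y * y) v) = (β : ℂ) := by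
      rw [hβ, _root_.smul_apply, hv, inner_smul_right, inner_self_ofReal, hv1]
      simp
    rw [mul_apply_eq_comp, star_eq_adjoint, ContinuousLinearMap.adjoint_inner_right,
      inner_self_ofReal] at h1
    have h2 : ‖y v‖ ^ 2 = β := by exact_mod_cast h1
    refine lt_of_le_of_ne (h2 ▸ by positivity) fun h0 => hy0 ?_
    rw [← CStarRing.star_mul_self_eq_zero_iff, hβ, ← h0]
    simp
  have hc : ((√β)⁻¹ * (√β)⁻¹ * β : ℝ) = 1 := by
    rw [← mul_inv, Real.mul_self_sqrt hβpos.le, inv_mul_cancel₀ hβpos.ne']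
  refine ⟨(((√β)⁻¹ : ℝ) : ℂ) • y, (commutant A).smul_mem hy _, ?_, ?_⟩
  · rw [star_smul, smul_mul_smul_comm, hβ, smul_smul, RCLike.star_def, Complex.conj_ofReal]
    rw [← Complex.ofReal_mul, ← Complex.ofReal_mul, hc, Complex.ofReal_one, one_smul]
  · rw [star_smul, smul_mul_smul_comm, hβ', ← hββ', smul_smul, RCLike.star_def,
      Complex.conj_ofReal]
    rw [← Complex.ofReal_mul, ← Complex.ofReal_mul, hc, Complex.ofReal_one, one_smul]

end Projections

/-! ### Decomposition into irreducible reducing subspaces -/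

section Decomposition

variable {K : Type*} [NormedAddCommGroup K] [InnerProductSpace ℂ K] [CompleteSpace K]
  {κ : Type*} {A : κ → K →L[ℂ] K} {T : Type*} {s : T → NormalState K}

lemma mul_rankOne_mul (x y : K →L[ℂ] K) (v w : K) :
    x * rankOne ℂ v w * y = rankOne ℂ (x v) (adjoint y w) := by
  ext z
  simp [ContinuousLinearMap.adjoint_inner_left]

lemma _root_.IsStarProjection.inner_apply {p : K →L[ℂ] K} (hp : IsStarProjection p) (v w : K) :
    inner ℂ (p v) w = inner ℂ v (p w) := by
  rw [← ContinuousLinearMap.adjoint_inner_right, ← star_eq_adjoint, hp.isSelfAdjoint.star_eq]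

lemma _root_.IsStarProjection.apply_apply {p : K →L[ℂ] K} (hp : IsStarProjection p) (v : K) :
    p (p v) = p v :=
  DFunLike.congr_fun hp.isIdempotentElem.eq v

lemma _root_.IsStarProjection.inner_self {p : K →L[ℂ] K} (hp : IsStarProjection p) (v : K) :
    inner ℂ v (p v) = ((‖p v‖ ^ 2 : ℝ) : ℂ) := by
  rw [← inner_self_ofReal, hp.inner_apply, hp.apply_apply]

/-- A spectral cut: if `h` in the commutant has an expectation value above `c`, the closed range
of `(h - c)⁺` is a nonzero reducing subspace on which `h ≥ c`. -/
lemma exists_spectral_cut (σ : NormalState K) {h : K →L[ℂ] K} (hh : h ∈ commutant A)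
    (hs : IsSelfAdjoint h) {c : ℝ} (hc : 0 < c) (hexp : c < (σ.expect h).re) :
    ∃ p ∈ commutant A, IsStarProjection p ∧ p ≠ 0 ∧
      (∀ q : K →L[ℂ] K, IsSelfAdjoint q → q * h = h → q * p = p) ∧
      ∀ v, c * ‖p v‖ ^ 2 ≤ (inner ℂ (p v) (h (p v))).re := by
  set a : K →L[ℂ] K := h - (c : ℂ) • 1 with ha
  have hamem : a ∈ commutant A := sub_mem hh ((commutant A).smul_mem (one_mem _) _)
  have has : IsSelfAdjoint a := by
    refine hs.sub ?_
    rw [isSelfAdjoint_iff, star_smul, star_one]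
    simp
  have hg0 : (0 : K →L[ℂ] K) ≤ a⁺ := CFC.posPart_nonneg a
  have hginner : ∀ w, c * ‖(a⁺ : K →L[ℂ] K) w‖ ^ 2 ≤
      (inner ℂ ((a⁺ : K →L[ℂ] K) w) (h ((a⁺ : K →L[ℂ] K) w))).re := by
    intro w
    have h1 : h ((a⁺ : K →L[ℂ] K) w) = (a⁺ : K →L[ℂ] K) ((a⁺ : K →L[ℂ] K) w) +
        (c : ℂ) • (a⁺ : K →L[ℂ] K) w := by
      have := DFunLike.congr_fun (mul_posPart_eq a has) w
      rw [mul_apply_eq_comp, mul_apply_eq_comp] at this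
      rw [← this, ha]
      simp
    have h2 : 0 ≤ (inner ℂ ((a⁺ : K →L[ℂ] K) w)
        ((a⁺ : K →L[ℂ] K) ((a⁺ : K →L[ℂ] K) w))).re :=
      ((nonneg_iff_isPositive _).1 hg0).re_inner_nonneg_right _
    rw [h1, inner_add_right, inner_smul_right, inner_self_ofReal, ← Complex.ofReal_mul,
      Complex.add_re, Complex.ofReal_re]
    linarith
  obtain ⟨p, hp, hpp, hpg, hpx, hpcl⟩ := exists_support (posPart_mem_commutant hamem)
  refine ⟨p, hp, hpp, ?_, ?_, ?_⟩
  · rintro rfl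
    have hg : (a⁺ : K →L[ℂ] K) = 0 := by rw [← hpg, zero_mul]
    have hsub := CFC.posPart_sub_negPart a has
    rw [hg, zero_sub] at hsub
    have hn : ∀ v, (inner ℂ v (h v)).re ≤ c * ‖v‖ ^ 2 := by
      intro v
      have h1 : h v = (c : ℂ) • v - (a⁻ : K →L[ℂ] K) v := by
        have := DFunLike.congr_fun hsub v
        rw [_root_.neg_apply, ha, _root_.sub_apply, _root_.smul_apply, one_apply_eq_self] at this
        rw [sub_eq_add_neg, this]
        abel
      have h2 : 0 ≤ (inner ℂ v ((a⁻ : K →L[ℂ] K) v)).re :=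
        ((nonneg_iff_isPositive _).1 (CFC.negPart_nonneg a)).re_inner_nonneg_right _
      rw [h1, inner_sub_right, inner_smul_right, inner_self_ofReal, ← Complex.ofReal_mul,
        Complex.sub_re, Complex.ofReal_re]
      linarith
    have h3 := hasSum_le (fun i => hn (σ.vec i)) (Complex.hasSum_re (σ.hasSum_expect h))
      (σ.hasSum_norm_sq.mul_left c)
    linarith
  · intro q hqs hq
    refine one_sub_mul_eq_zero.1 (hpx _ ?_)
    have hqh : h * (1 - q) = 0 := by
      have := congrArg star (one_sub_mul_eq_zero.2 hq)
      rwa [star_mul, star_sub, star_one, hqs.star_eq, hs.star_eq, star_zero] at this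
    have hcomm : Commute a (1 - q) := by
      refine Commute.sub_left ?_ ?_
      · rw [commute_iff_eq, hqh, one_sub_mul_eq_zero.2 hq]
      · exact (Commute.one_left _).smul_left _
    ext w
    have h1 : ((1 - q) * (a⁺ : K →L[ℂ] K)) w = (a⁺ : K →L[ℂ] K) ((1 - q) w) :=
      DFunLike.congr_fun (commute_posPart hcomm).eq.symm w
    have h2 := hginner ((1 - q) w)
    rw [← h1, ← mul_apply_eq_comp h, ← mul_assoc, hqh, zero_mul, _root_.zero_apply,
      inner_zero_right, Complex.zero_re] at h2
    have h3 : ‖((1 - q) * (a⁺ : K →L[ℂ] K)) w‖ ^ 2 ≤ 0 := by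
      by_contra! hcon
      nlinarith
    have h4 : ‖((1 - q) * (a⁺ : K →L[ℂ] K)) w‖ = 0 := by
      nlinarith [norm_nonneg (((1 - q) * (a⁺ : K →L[ℂ] K)) w)]
    simpa using norm_eq_zero.1 h4
  · intro v
    have hclosed : IsClosed {u : K | c * ‖u‖ ^ 2 ≤ (inner ℂ u (h u)).re} := by
      refine isClosed_le (by fun_prop) ?_
      exact Complex.continuous_re.comp (continuous_id.inner h.continuous)
    refine closure_minimal ?_ hclosed (hpcl v)
    rintro _ ⟨w, rfl⟩
    exact hginner w

/-- Every nonzero reducing subspace contains an irreducible one. For a unit of mass `e` in it, the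
conditional expectation `h` of `|e⟩⟨e|` has a spectral cut `p` on which `h ≥ c`. Every projection
`r ≤ p` of the commutant satisfies `c r ≤ r h r`, the conditional expectation of `|r e⟩⟨r e|`, so
that `c ≤ ‖r e‖ ^ 2`; a projection that minimises this additive quantity up to an error smaller
than `c` admits no proper subprojection. -/
theorem ConditionalExpectation.exists_irreducible_le (E : ConditionalExpectation A s)
    (hfaith : ∀ X : K →L[ℂ] K, (∀ t i, X ((s t).vec i) = 0) → X = 0) {q : K →L[ℂ] K}
    (hq : q ∈ commutant A) (hqp : IsStarProjection q) (hq0 : q ≠ 0) :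
    ∃ p, IsIrreducibleProj A p ∧ q * p = p := by
  obtain ⟨t, i, hti⟩ : ∃ t i, q ((s t).vec i) ≠ 0 := by
    by_contra! h
    exact hq0 (hfaith q h)
  set e : K := q ((s t).vec i) with he
  have hqe : q e = e := hqp.apply_apply _
  set h : K →L[ℂ] K := E.toLin (rankOne ℂ e e) with hh
  have hhs : IsSelfAdjoint h := by
    rw [isSelfAdjoint_iff, hh, ← E.map_star]
    congr 1
    ext v
    refine ext_inner_left ℂ fun w => ?_
    rw [star_eq_adjoint, ContinuousLinearMap.adjoint_inner_right, rankOne_apply, rankOne_apply,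
      inner_smul_left, inner_smul_right, inner_conj_symm]
    ring
  have hqh : q * h = h := by
    have h1 := E.bimodule q hq 1 (one_mem _) (rankOne ℂ e e)
    rw [mul_rankOne_mul, mul_one, hqe, ← star_eq_adjoint, star_one, one_apply_eq_self] at h1
    exact h1.symm
  -- the expectation value of `|e⟩⟨e|` is positive because `e` has overlap with `vec i`
  have hpos : 0 < ((s t).expect h).re := by
    rw [hh, E.expect]
    have h2 := ((s t).expect_rankOne_self e).1
    have h3 := le_hasSum h2 i (fun j _ => by positivity)
    refine lt_of_lt_of_le ?_ h3
    have h4 : inner ℂ e ((s t).vec i) = ((‖e‖ ^ 2 : ℝ) : ℂ) := by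
      rw [he, hqp.inner_apply, hqp.inner_self]
    have h5 : 0 < ‖e‖ := norm_pos_iff.2 hti
    rw [h4, Complex.norm_real, Real.norm_of_nonneg (by positivity)]
    positivity
  obtain ⟨p, hp, hpp, hp0, hpq, hpc⟩ := exists_spectral_cut (s t) (E.mem _) hhs (half_pos hpos)
    (half_lt_self hpos)
  set c : ℝ := ((s t).expect h).re / 2 with hcdef
  have hc : 0 < c := half_pos hpos
  have hqp' : q * p = p := hpq q hqp.isSelfAdjoint hqh
  have hlower : ∀ r ∈ commutant A, IsStarProjection r → r ≠ 0 → p * r = r → c ≤ ‖r e‖ ^ 2 := by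
    intro r hr hrp hr0 hpr
    obtain ⟨w, hw⟩ : ∃ w, r w ≠ 0 := by
      by_contra! hcon
      exact hr0 (ContinuousLinearMap.ext hcon)
    have h1 : r * h * r = E.toLin (rankOne ℂ (r e) (r e)) := by
      rw [hh, ← E.bimodule r hr r hr, mul_rankOne_mul, ← star_eq_adjoint,
        hrp.isSelfAdjoint.star_eq]
    have h2 : ‖r * h * r‖ ≤ ‖r e‖ ^ 2 := by
      rw [h1]
      refine (E.norm_le _).trans_eq ?_
      rw [norm_rankOne, sq]
    have h3 := hpc (r w)
    have hprw : p (r w) = r w := DFunLike.congr_fun hpr w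
    have h4 : inner ℂ (p (r w)) (h (p (r w))) = inner ℂ (r w) ((r * h * r) (r w)) := by
      rw [hprw, mul_apply_eq_comp, mul_apply_eq_comp, hrp.apply_apply, ← hrp.inner_apply,
        hrp.apply_apply]
    rw [h4, hprw] at h3
    have h5 : (inner ℂ (r w) ((r * h * r) (r w))).re ≤ ‖r e‖ ^ 2 * ‖r w‖ ^ 2 := by
      refine (Complex.re_le_norm _).trans ((norm_inner_le_norm _ _).trans ?_)
      calc _ ≤ ‖r w‖ * (‖r e‖ ^ 2 * ‖r w‖) := by
            gcongr
            exact ContinuousLinearMap.le_of_opNorm_le _ h2 _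
        _ = _ := by ring
    have h6 : 0 < ‖r w‖ ^ 2 := by
      have := norm_pos_iff.2 hw
      positivity
    exact le_of_mul_le_mul_right (h3.trans h5) h6
  let S : Set ℝ := {x | ∃ r ∈ commutant A, IsStarProjection r ∧ r ≠ 0 ∧ p * r = r ∧
    x = ‖r e‖ ^ 2}
  have hSne : S.Nonempty := ⟨_, p, hp, hpp, hp0, hpp.isIdempotentElem.eq, rfl⟩
  have hSbdd : BddBelow S := ⟨c, by rintro _ ⟨r, h1, h2, h3, h4, rfl⟩; exact hlower r h1 h2 h3 h4⟩
  obtain ⟨_, ⟨r, hr, hrp, hr0, hpr, rfl⟩, hlt⟩ :=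
    exists_lt_of_csInf_lt hSne (lt_add_of_pos_right (sInf S) hc)
  refine ⟨r, ⟨hr, hrp, hr0, ?_⟩, ?_⟩
  · intro r' hr' hrp' hrr'
    by_contra! hcon
    obtain ⟨h1, h2⟩ := hcon
    have hr'r : r' * r = r' := mul_eq_self_of_star hrp hrp'.isSelfAdjoint.star_eq hrr'
    have hsub : IsStarProjection (r - r') := hrp'.sub_of_mul_eq_left hrp hr'r
    have hle1 : sInf S ≤ ‖r' e‖ ^ 2 :=
      csInf_le hSbdd ⟨r', hr', hrp', h1, by rw [← hrr', ← mul_assoc, hpr], rfl⟩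
    have hle2 : c ≤ ‖(r - r') e‖ ^ 2 := by
      refine hlower _ (sub_mem hr hr') hsub (sub_ne_zero.2 (Ne.symm h2)) ?_
      rw [mul_sub, hpr, ← hrr', ← mul_assoc, hpr]
    have hadd : ‖r e‖ ^ 2 = ‖r' e‖ ^ 2 + ‖(r - r') e‖ ^ 2 := by
      have h3 : inner ℂ e (r e) = inner ℂ e (r' e) + inner ℂ e ((r - r') e) := by
        rw [_root_.sub_apply, inner_sub_right]
        ring
      rw [hrp.inner_self, hrp'.inner_self, hsub.inner_self] at h3
      exact_mod_cast h3
    linarith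
  · rw [← hpr, ← mul_assoc, hqp']

/-- The space is the orthogonal sum of irreducible reducing subspaces, by Zorn's lemma. -/
theorem ConditionalExpectation.exists_irreducible_family (E : ConditionalExpectation A s)
    (hfaith : ∀ X : K →L[ℂ] K, (∀ t i, X ((s t).vec i) = 0) → X = 0) :
    ∃ I : Set (K →L[ℂ] K), (∀ p ∈ I, IsIrreducibleProj A p) ∧
      (∀ p ∈ I, ∀ q ∈ I, p ≠ q → p * q = 0) ∧ ∀ v, (∀ p ∈ I, p v = 0) → v = 0 := by
  let S : Set (Set (K →L[ℂ] K)) := {I | (∀ p ∈ I, IsIrreducibleProj A p) ∧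
      (∀ p ∈ I, ∀ q ∈ I, p ≠ q → p * q = 0)}
  obtain ⟨I, hI⟩ := zorn_subset S (by
    intro C hC hchain
    refine ⟨⋃₀ C, ⟨?_, ?_⟩, fun J hJ => Set.subset_sUnion_of_mem hJ⟩
    · rintro p ⟨J, hJ, hp⟩
      exact (hC hJ).1 p hp
    · rintro p ⟨J, hJ, hp⟩ q ⟨J', hJ', hq⟩ hpq
      rcases hchain.total hJ hJ' with h | h
      · exact (hC hJ').2 p (h hp) q hq hpq
      · exact (hC hJ).2 p hp q (h hq) hpq)
  refine ⟨I, hI.prop.1, hI.prop.2, ?_⟩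
  by_contra! hcon
  obtain ⟨v, hv, hv0⟩ := hcon
  let W : Submodule ℂ K := ⨅ p : I, LinearMap.ker ((p : K →L[ℂ] K) : K →ₗ[ℂ] K)
  have hmemW : ∀ u, u ∈ W ↔ ∀ p ∈ I, p u = 0 := by
    intro u
    simp [W]
  have hWc : IsClosed (W : Set K) := by
    have : (W : Set K) = ⋂ p : I, {u | (p : K →L[ℂ] K) u = 0} := by
      ext u
      simp [hmemW]
    rw [this]
    exact isClosed_iInter fun p => isClosed_eq (p : K →L[ℂ] K).continuous continuous_const
  have : CompleteSpace W := hWc.completeSpace_coe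
  have hr : W.starProjection ∈ commutant A := by
    refine starProjection_mem_commutant W ?_ ?_
    · intro k u hu
      rw [hmemW] at hu ⊢
      intro p hp
      rw [← commutant_apply (hI.prop.1 p hp).mem, hu p hp, map_zero]
    · intro k u hu
      rw [hmemW] at hu ⊢
      intro p hp
      rw [← commutant_adjoint_apply (hI.prop.1 p hp).mem, hu p hp, map_zero]
  have hr0 : W.starProjection ≠ 0 := by
    intro h0
    have h1 : W.starProjection v = v :=
      Submodule.starProjection_eq_self_iff.2 ((hmemW v).2 hv)
    rw [h0] at h1
    exact hv0 h1.symm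
  obtain ⟨r, hrirr, hWr⟩ := E.exists_irreducible_le hfaith hr isStarProjection_starProjection hr0
  have hpr : ∀ p ∈ I, p * r = 0 := by
    intro p hp
    ext u
    have h1 : W.starProjection (r u) = r u := DFunLike.congr_fun hWr u
    exact (hmemW _).1 (Submodule.starProjection_eq_self_iff.1 h1) p hp
  have hrp : ∀ p ∈ I, r * p = 0 := by
    intro p hp
    have h1 := congrArg star (hpr p hp)
    rwa [star_mul, hrirr.isStarProjection.isSelfAdjoint.star_eq,
      (hI.prop.1 p hp).isStarProjection.isSelfAdjoint.star_eq, star_zero] at h1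
  have hrI : r ∉ I := by
    intro hmem
    have := hpr r hmem
    rw [hrirr.isStarProjection.isIdempotentElem.eq] at this
    exact hrirr.ne_zero this
  refine hrI (hI.le_of_ge (y := insert r I) ⟨?_, ?_⟩ (Set.subset_insert r I)
    (Set.mem_insert r I))
  · rintro p (rfl | hp)
    · exact hrirr
    · exact hI.prop.1 p hp
  · rintro p (rfl | hp) q (rfl | hq) hpq
    · exact absurd rfl hpq
    · exact hrp q hq
    · exact hpr p hp
    · exact hI.prop.2 p hp q hq hpq

/-- The blocks of an invariant density operator between copies of an irreducible subspace are
multiples of one and the same form on that subspace: by Schur's lemma the conditional expectation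
of `|f'⟩⟨f|` is a multiple `B f f'` of the projection. -/
theorem ConditionalExpectation.exists_form (E : ConditionalExpectation A s)
    {ρ : T → K →L[ℂ] K} (hρ : ∀ t, (s t).Represents (ρ t)) {p : K →L[ℂ] K}
    (hp : IsIrreducibleProj A p) : ∃ B : K → K → ℂ, ∀ w₁ ∈ commutant A, ∀ w₂ ∈ commutant A,
      w₂ * p = w₂ → ∀ f f', p f = f → p f' = f' → ∀ t,
      inner ℂ (w₁ f) (ρ t (w₂ f')) = (s t).expect (w₂ * star w₁) * B f f' := by
  have hps := hp.isStarProjection.isSelfAdjoint.star_eq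
  have h1 : ∀ f f', ∃ β : ℂ, p f = f → p f' = f' → E.toLin (rankOne ℂ f' f) = β • p := by
    intro f f'
    by_cases h : p f = f ∧ p f' = f'
    · obtain ⟨hf, hf'⟩ := h
      have e1 := E.bimodule p hp.mem 1 (one_mem _) (rankOne ℂ f' f)
      have e2 := E.bimodule 1 (one_mem _) p hp.mem (rankOne ℂ f' f)
      rw [mul_rankOne_mul, mul_one, hf', ← star_eq_adjoint, star_one, one_apply_eq_self] at e1
      rw [mul_rankOne_mul, one_mul, ← star_eq_adjoint, hps, hf, one_apply_eq_self] at e2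
      obtain ⟨β, hβ⟩ := hp.exists_smul (E.mem (rankOne ℂ f' f)) e1.symm e2.symm
      exact ⟨β, fun _ _ => hβ⟩
    · exact ⟨0, fun a b => absurd ⟨a, b⟩ h⟩
  choose B hB using h1
  refine ⟨B, fun w₁ h₁ w₂ h₂ hw₂ f f' hf hf' t => ?_⟩
  have e := E.bimodule w₂ h₂ (star w₁) (star_mem h₁) (rankOne ℂ f' f)
  rw [mul_rankOne_mul, star_eq_adjoint, ContinuousLinearMap.adjoint_adjoint, hB f f' hf hf',
    mul_smul_comm, hw₂, smul_mul_assoc] at e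
  rw [← hρ t, ← E.expect t, e, map_smul, smul_eq_mul, mul_comm, star_eq_adjoint]

/-- The blocks of an invariant density operator between copies of inequivalent irreducible
subspaces vanish: the conditional expectation of `|f'⟩⟨f|` is an intertwiner. -/
theorem ConditionalExpectation.inner_eq_zero (E : ConditionalExpectation A s)
    {ρ : T → K →L[ℂ] K} (hρ : ∀ t, (s t).Represents (ρ t)) {p q : K →L[ℂ] K}
    (hp : IsIrreducibleProj A p) (hq : IsIrreducibleProj A q) (hpq : ¬ ProjEquiv A p q)
    {w₁ w₂ : K →L[ℂ] K} (h₁ : w₁ ∈ commutant A) (h₂ : w₂ ∈ commutant A)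
    {f f' : K} (hf : p f = f) (hf' : q f' = f') (t : T) :
    inner ℂ (w₁ f) (ρ t (w₂ f')) = 0 := by
  have e1 := E.bimodule q hq.mem 1 (one_mem _) (rankOne ℂ f' f)
  have e2 := E.bimodule 1 (one_mem _) p hp.mem (rankOne ℂ f' f)
  rw [mul_rankOne_mul, mul_one, hf', ← star_eq_adjoint, star_one, one_apply_eq_self] at e1
  rw [mul_rankOne_mul, one_mul, ← star_eq_adjoint, hp.isStarProjection.isSelfAdjoint.star_eq, hf,
    one_apply_eq_self] at e2
  have h0 : E.toLin (rankOne ℂ f' f) = 0 := by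
    by_contra h
    exact hpq (projEquiv_of_intertwiner hp hq (E.mem _) e1.symm e2.symm h)
  have e := E.bimodule w₂ h₂ (star w₁) (star_mem h₁) (rankOne ℂ f' f)
  rw [mul_rankOne_mul, star_eq_adjoint, ContinuousLinearMap.adjoint_adjoint, h0, mul_zero,
    zero_mul] at e
  rw [← hρ t, ← E.expect t, e, map_zero]

end Decomposition

/-! ### Isotypic subspaces as Hilbert tensor products -/

section Isotypic

variable {J F K : Type u} [NormedAddCommGroup F] [InnerProductSpace ℂ F]
  [NormedAddCommGroup K] [InnerProductSpace ℂ K]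

lemma memℓp_smul (c : lp (fun _ : J => ℂ) 2) (f : F) :
    Memℓp (fun i => c i • f : ∀ _ : J, F) 2 := by
  have h := (lp.memℓp c).summable (by norm_num)
  refine (memℓp_gen_iff (by norm_num)).2 ?_
  refine (h.mul_right (‖f‖ ^ (2 : ℝ≥0∞).toReal)).congr fun i => ?_
  rw [norm_smul, Real.mul_rpow (norm_nonneg _) (norm_nonneg _)]

/-- The vector `(c i • f)ᵢ` of the Hilbert sum of copies of `F`. -/
def smulVec (c : lp (fun _ : J => ℂ) 2) (f : F) : lp (fun _ : J => F) 2 :=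
  ⟨fun i => c i • f, memℓp_smul c f⟩

lemma inner_smulVec (c c' : lp (fun _ : J => ℂ) 2) (f f' : F) :
    inner ℂ (smulVec c f) (smulVec c' f') = inner ℂ c c' * inner ℂ f f' := by
  refine (lp.hasSum_inner (smulVec c f) (smulVec c' f')).unique ?_
  have e : ∀ i, inner ℂ (smulVec c f i) (smulVec c' f' i) =
      inner ℂ (c i) (c' i) * inner ℂ f f' := by
    intro i
    change inner ℂ (c i • f) (c' i • f') = _
    rw [inner_smul_left, inner_smul_right, RCLike.inner_apply]
    ring
  simp only [e]
  exact (lp.hasSum_inner c c').mul_right (inner ℂ f f')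

variable [CompleteSpace K] {U : J → F →ₗᵢ[ℂ] K}

/-- The map `c ⊗ f ↦ ∑ i, c i • U i f` on the algebraic tensor product. -/
noncomputable def isotypicLin (hU : OrthogonalFamily ℂ (fun _ : J => F) U) :
    (lp (fun _ : J => ℂ) 2) ⊗[ℂ] F →ₗ[ℂ] K :=
  TensorProduct.lift (LinearMap.mk₂ ℂ (fun c f => hU.linearIsometry (smulVec c f))
    (fun c c' f => by
      rw [← map_add]; congr 1; ext i; exact add_smul _ _ _)
    (fun a c f => by
      rw [← map_smul]; congr 1; ext i; exact mul_smul _ _ _)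
    (fun c f f' => by
      rw [← map_add]; congr 1; ext i; exact smul_add _ _ _)
    (fun a c f => by
      rw [← map_smul]; congr 1; ext i; exact smul_comm _ _ _))

lemma isotypicLin_tmul (hU : OrthogonalFamily ℂ (fun _ : J => F) U) (c : lp (fun _ : J => ℂ) 2)
    (f : F) : isotypicLin hU (c ⊗ₜ f) = hU.linearIsometry (smulVec c f) := rfl

lemma inner_isotypicLin (hU : OrthogonalFamily ℂ (fun _ : J => F) U)
    (x y : (lp (fun _ : J => ℂ) 2) ⊗[ℂ] F) :
    inner ℂ (isotypicLin hU x) (isotypicLin hU y) = inner ℂ x y := by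
  induction x with
  | zero => simp
  | add x x' hx hx' => rw [map_add, inner_add_left, inner_add_left, hx, hx']
  | tmul c f =>
    induction y with
    | zero => simp
    | add y y' hy hy' => rw [map_add, inner_add_right, inner_add_right, hy, hy']
    | tmul c' f' =>
      rw [isotypicLin_tmul, isotypicLin_tmul, LinearIsometry.inner_map_map, inner_smulVec,
        TensorProduct.inner_tmul]

/-- The isometry `c ⊗ f ↦ ∑ i, c i • U i f` from the Hilbert tensor product of `ℓ²(J)` and `F`,
for isometries `U i` with mutually orthogonal ranges. -/
noncomputable def isotypic (hU : OrthogonalFamily ℂ (fun _ : J => F) U) :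
    HilbertTensor (lp (fun _ : J => ℂ) 2) F →ₗᵢ[ℂ] K :=
  let f := ((isotypicLin hU).isometryOfInner (inner_isotypicLin hU)).toContinuousLinearMap
  { (f.extend (UniformSpace.Completion.toComplL (𝕜 := ℂ))).toLinearMap with
    norm_map' := fun x => by
      have hd : DenseRange (UniformSpace.Completion.toComplL (𝕜 := ℂ)
          (E := (lp (fun _ : J => ℂ) 2) ⊗[ℂ] F)) := UniformSpace.Completion.denseRange_coe
      have hi : IsUniformInducing (UniformSpace.Completion.toComplL (𝕜 := ℂ)
          (E := (lp (fun _ : J => ℂ) 2) ⊗[ℂ] F)) :=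
        UniformSpace.Completion.isUniformInducing_coe _
      change ‖f.extend (UniformSpace.Completion.toComplL (𝕜 := ℂ)) x‖ = ‖x‖
      induction x using UniformSpace.Completion.induction_on with
      | hp => exact isClosed_eq (ContinuousLinearMap.continuous _).norm continuous_norm
      | ih a =>
        have h1 := ContinuousLinearMap.extend_eq f hd hi a
        rw [UniformSpace.Completion.norm_coe]
        refine (congrArg norm h1).trans ?_
        exact ((isotypicLin hU).isometryOfInner (inner_isotypicLin hU)).norm_map a }

lemma isotypic_coe (hU : OrthogonalFamily ℂ (fun _ : J => F) U)
    (x : (lp (fun _ : J => ℂ) 2) ⊗[ℂ] F) :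
    isotypic hU (x : HilbertTensor (lp (fun _ : J => ℂ) 2) F) = isotypicLin hU x :=
  ContinuousLinearMap.extend_eq
    ((isotypicLin hU).isometryOfInner (inner_isotypicLin hU)).toContinuousLinearMap
    (e := UniformSpace.Completion.toComplL (𝕜 := ℂ)) UniformSpace.Completion.denseRange_coe
    (UniformSpace.Completion.isUniformInducing_coe _) x

open Classical in
lemma isotypic_single (hU : OrthogonalFamily ℂ (fun _ : J => F) U) (i : J) (f : F) :
    isotypic hU (((lp.single 2 i (1 : ℂ) : lp (fun _ : J => ℂ) 2) ⊗ₜ[ℂ] f :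
      (lp (fun _ : J => ℂ) 2) ⊗[ℂ] F) : HilbertTensor (lp (fun _ : J => ℂ) 2) F) = U i f := by
  rw [isotypic_coe, isotypicLin_tmul, ← hU.linearIsometry_apply_single f]
  congr 1
  ext j
  change (lp.single 2 i (1 : ℂ) : lp (fun _ : J => ℂ) 2) j • f = _
  rw [lp.coeFn_single, lp.coeFn_single]
  by_cases h : j = i
  · subst h
    simp
  · simp [Pi.single_eq_of_ne h]

open Classical in
/-- Operators on `ℓ²(J) ⊗ F` are determined by their values on `e i ⊗ f`. -/
lemma isotypic_ext {G : Type*} [NormedAddCommGroup G] [NormedSpace ℂ G]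
    {S T : HilbertTensor (lp (fun _ : J => ℂ) 2) F →L[ℂ] G}
    (h : ∀ i f, S (((lp.single 2 i (1 : ℂ) : lp (fun _ : J => ℂ) 2) ⊗ₜ[ℂ] f :
      (lp (fun _ : J => ℂ) 2) ⊗[ℂ] F) : HilbertTensor (lp (fun _ : J => ℂ) 2) F) =
      T (((lp.single 2 i (1 : ℂ) : lp (fun _ : J => ℂ) 2) ⊗ₜ[ℂ] f :
      (lp (fun _ : J => ℂ) 2) ⊗[ℂ] F) : HilbertTensor (lp (fun _ : J => ℂ) 2) F)) : S = T := by
  have htmul : ∀ (f : F) (c : lp (fun _ : J => ℂ) 2),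
      S ((c ⊗ₜ[ℂ] f : (lp (fun _ : J => ℂ) 2) ⊗[ℂ] F) :
        HilbertTensor (lp (fun _ : J => ℂ) 2) F) =
      T ((c ⊗ₜ[ℂ] f : (lp (fun _ : J => ℂ) 2) ⊗[ℂ] F) :
        HilbertTensor (lp (fun _ : J => ℂ) 2) F) := by
    intro f c
    let R : lp (fun _ : J => ℂ) 2 →L[ℂ] HilbertTensor (lp (fun _ : J => ℂ) 2) F :=
      UniformSpace.Completion.toComplL ∘L (TensorProduct.mkL ℂ (lp (fun _ : J => ℂ) 2) F).flip f
    have : S ∘L R = T ∘L R := by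
      refine lp.ext_continuousLinearMap ENNReal.ofNat_ne_top fun i => ?_
      ext
      exact h i f
    exact DFunLike.congr_fun this c
  ext x
  induction x using UniformSpace.Completion.induction_on with
  | hp => exact isClosed_eq S.continuous T.continuous
  | ih a =>
    induction a with
    | zero => rw [UniformSpace.Completion.coe_zero, map_zero, map_zero]
    | add x y hx hy => rw [UniformSpace.Completion.coe_add, map_add, map_add, hx, hy]
    | tmul c f => exact htmul f c

lemma opTensor_coe_tmul {C : Type u} [NormedAddCommGroup C] [InnerProductSpace ℂ C]
    (a : C →L[ℂ] C) (b : F →L[ℂ] F) (c : C) (f : F) :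
    opTensor a b ((c ⊗ₜ[ℂ] f : C ⊗[ℂ] F) : HilbertTensor C F) =
      ((a c ⊗ₜ[ℂ] b f : C ⊗[ℂ] F) : HilbertTensor C F) := by
  rw [opTensor, ContinuousLinearMap.completion_apply_coe, TensorProduct.mapL_tmul]

/-- An operator that acts on every copy of `F` as `b` is `1 ⊗ b`. -/
lemma isotypic_intertwines (hU : OrthogonalFamily ℂ (fun _ : J => F) U) (B : K →L[ℂ] K)
    (b : F →L[ℂ] F) (h : ∀ i f, B (U i f) = U i (b f))
    (v : HilbertTensor (lp (fun _ : J => ℂ) 2) F) :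
    B (isotypic hU v) = isotypic hU (opTensor (ContinuousLinearMap.id ℂ _) b v) := by
  classical
  have : B ∘L (isotypic hU).toContinuousLinearMap =
      (isotypic hU).toContinuousLinearMap ∘L opTensor (ContinuousLinearMap.id ℂ _) b := by
    refine isotypic_ext fun i f => ?_
    change B (isotypic hU _) = isotypic hU (opTensor _ b _)
    rw [opTensor_coe_tmul, isotypic_single, h, ContinuousLinearMap.id_apply, isotypic_single]
  exact DFunLike.congr_fun this v

/-- The slice `c ↦ isotypic (c ⊗ f)`. -/
noncomputable def isotypicSlice (hU : OrthogonalFamily ℂ (fun _ : J => F) U) (f : F) :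
    lp (fun _ : J => ℂ) 2 →L[ℂ] K :=
  (isotypic hU).toContinuousLinearMap ∘L UniformSpace.Completion.toComplL ∘L
    (TensorProduct.mkL ℂ (lp (fun _ : J => ℂ) 2) F).flip f

open Classical in
lemma isotypicSlice_single (hU : OrthogonalFamily ℂ (fun _ : J => F) U) (f : F) (i : J) :
    isotypicSlice hU f (lp.single 2 i (1 : ℂ)) = U i f := isotypic_single hU i f

end Isotypic

/-! ### Splittings from families of isometries -/

section Splitting

variable {K : Type u} [NormedAddCommGroup K] [InnerProductSpace ℂ K] [CompleteSpace K]
  {ι : Type u} {J F : ι → Type u} [∀ n, NormedAddCommGroup (F n)]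
  [∀ n, InnerProductSpace ℂ (F n)] {U : ∀ n, J n → F n →ₗᵢ[ℂ] K}

lemma isHilbertSum_isotypic (hU : ∀ n, OrthogonalFamily ℂ (fun _ : J n => F n) (U n))
    (horth : ∀ n m, n ≠ m → ∀ i j f g, inner ℂ (U n i f) (U m j g) = 0)
    (htotal : ∀ v, (∀ n i f, inner ℂ (U n i f) v = 0) → v = 0) :
    IsHilbertSum ℂ (fun n => HilbertTensor (lp (fun _ : J n => ℂ) 2) (F n))
      (fun n => isotypic (hU n)) := by
  classical
  refine IsHilbertSum.mk ?_ ?_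
  · intro n m hnm v w
    have h1 : ∀ (i : J n) (f : F n), ((innerSL ℂ (U n i f)) ∘L
        (isotypic (hU m)).toContinuousLinearMap) = 0 := by
      intro i f
      refine isotypic_ext fun j g => ?_
      change inner ℂ (U n i f) (isotypic (hU m) _) = _
      rw [isotypic_single, horth n m hnm, _root_.zero_apply]
    have h2 : ((innerSL ℂ (isotypic (hU m) w)) ∘L
        (isotypic (hU n)).toContinuousLinearMap) = 0 := by
      refine isotypic_ext fun i f => ?_
      change inner ℂ (isotypic (hU m) w) (isotypic (hU n) _) = _
      rw [isotypic_single, _root_.zero_apply, ← inner_conj_symm]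
      have : inner ℂ (U n i f) (isotypic (hU m) w) = 0 := DFunLike.congr_fun (h1 i f) w
      rw [this, map_zero]
    rw [← inner_conj_symm]
    have : inner ℂ (isotypic (hU m) w) (isotypic (hU n) v) = 0 := DFunLike.congr_fun h2 v
    rw [this, map_zero]
  · rw [top_le_iff, Submodule.topologicalClosure_eq_top_iff, eq_bot_iff]
    intro v hv
    rw [Submodule.mem_orthogonal] at hv
    refine htotal v fun n i f => hv _ ?_
    refine Submodule.mem_iSup_of_mem n ⟨_, isotypic_single (hU n) i f⟩

/-- The splitting `⨁ n, ℓ²(J n) ⊗ F n` determined by isometries `U n i : F n → K` for `i : J n`,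
with mutually orthogonal ranges that span a dense subspace. -/
noncomputable def splittingOfFamily [∀ n, CompleteSpace (F n)]
    (hU : ∀ n, OrthogonalFamily ℂ (fun _ : J n => F n) (U n))
    (horth : ∀ n m, n ≠ m → ∀ i j f g, inner ℂ (U n i f) (U m j g) = 0)
    (htotal : ∀ v, (∀ n i f, inner ℂ (U n i f) v = 0) → v = 0) : TensorSplitting K where
  ι := ι
  C n := lp (fun _ : J n => ℂ) 2
  F := F
  iso := (isHilbertSum_isotypic hU horth htotal).linearIsometryEquiv.symm

lemma splittingOfFamily_incl [∀ n, CompleteSpace (F n)]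
    (hU : ∀ n, OrthogonalFamily ℂ (fun _ : J n => F n) (U n))
    (horth : ∀ n m, n ≠ m → ∀ i j f g, inner ℂ (U n i f) (U m j g) = 0)
    (htotal : ∀ v, (∀ n i f, inner ℂ (U n i f) v = 0) → v = 0) (n : ι)
    (v : HilbertTensor (lp (fun _ : J n => ℂ) 2) (F n)) :
    (splittingOfFamily hU horth htotal).incl n v = isotypic (hU n) v := by
  classical
  exact (isHilbertSum_isotypic hU horth htotal).linearIsometryEquiv_symm_apply_single v

end Splitting

/-! ### Compressions to closed subspaces -/

section Compression

variable {H : Type*} [NormedAddCommGroup H] [InnerProductSpace ℂ H] [CompleteSpace H]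

/-- The compression of the operator `X` to the closed subspace `V`. -/
noncomputable def compression (V : Submodule ℂ H) [CompleteSpace V] (X : H →L[ℂ] H) : V →L[ℂ] V :=
  adjoint V.subtypeL ∘L X ∘L V.subtypeL

variable (V : Submodule ℂ H) [CompleteSpace V]

lemma inner_compression (X : H →L[ℂ] H) (x y : V) :
    inner ℂ x (compression V X y) = inner ℂ (x : H) (X y) := by
  rw [compression, ContinuousLinearMap.comp_apply, ContinuousLinearMap.adjoint_inner_right]
  rfl

lemma coe_adjoint_subtypeL {x : H} (hx : x ∈ V) : (adjoint V.subtypeL x : H) = x := by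
  rw [Submodule.adjoint_subtypeL]
  exact congrArg Subtype.val
    (Submodule.orthogonalProjectionOnto_mem_subspace_eq_self (⟨x, hx⟩ : V))

lemma coe_compression {X : H →L[ℂ] H} (hX : ∀ v ∈ V, X v ∈ V) (v : V) :
    (compression V X v : H) = X v :=
  coe_adjoint_subtypeL V (hX v v.2)

lemma adjoint_compression (X : H →L[ℂ] H) :
    adjoint (compression V X) = compression V (adjoint X) := by
  rw [compression, adjoint_comp, adjoint_comp, adjoint_adjoint]
  rfl

end Compression

/-! ### Traces of blocks -/

section Traces

/-- Tonelli's theorem for nonnegative double series. -/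
lemma hasSum_swap {α β : Type*} {f : α → β → ℝ} {r : α → ℝ} {c : β → ℝ} {a : ℝ}
    (hf : ∀ i j, 0 ≤ f i j) (hr : ∀ i, HasSum (f i) (r i)) (hc : ∀ j, HasSum (fun i => f i j) (c j))
    (ha : HasSum c a) : HasSum r a := by
  have hr0 : ∀ i, 0 ≤ r i := fun i => (hr i).nonneg (hf i)
  have hc0 : ∀ j, 0 ≤ c j := fun j => (hc j).nonneg fun i => hf i j
  refine hasSum_of_tsum_ofReal hr0 (ha.nonneg hc0) ?_
  rw [← tsum_ofReal_sq hc0 ha]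
  simp only [← fun i => tsum_ofReal_sq (hf i) (hr i),
    ← fun j => tsum_ofReal_sq (fun i => hf i j) (hc j)]
  exact ENNReal.tsum_comm

/-- The standard Hilbert basis of `ℓ²(J)`. -/
noncomputable def lpBasis (J : Type*) : HilbertBasis J ℂ (lp (fun _ : J => ℂ) 2) :=
  HilbertBasis.ofRepr (LinearIsometryEquiv.refl ℂ _)

open Classical in
lemma lpBasis_apply {J : Type*} (i : J) : lpBasis J i = lp.single 2 i (1 : ℂ) :=
  ((lpBasis J).repr_symm_single i).symm

/-- A positive trace class operator on a nonzero space is its trace times a density operator. -/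
lemma exists_isDensityOperator_smul {C : Type*} [NormedAddCommGroup C] [InnerProductSpace ℂ C]
    [CompleteSpace C] {G : C →L[ℂ] C} (hG : G.IsPositive) {ι : Type*} (b : HilbertBasis ι ℂ C)
    (hι : Nonempty ι) {p : ℝ} (hp : HasSum (fun i => inner ℂ (b i) (G (b i))) (p : ℂ)) :
    0 ≤ p ∧ ∃ σ : C →L[ℂ] C, IsDensityOperator σ ∧ (p : ℂ) • σ = G := by
  obtain ⟨Y, hY, hYG⟩ := exists_sqrt hG
  simp only [inner_sqrt_self hY hYG] at hp
  have hp' := Complex.hasSum_ofReal.1 hp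
  have hp0 : 0 ≤ p := hp'.nonneg fun i => by positivity
  refine ⟨hp0, ?_⟩
  rcases hp0.eq_or_lt with h | h
  · -- the trace vanishes: `G = 0`, and any density operator will do
    obtain ⟨i⟩ := hι
    have hYb : ∀ j, Y (b j) = 0 := by
      intro j
      rw [← h] at hp'
      have := congrFun ((hasSum_zero_iff_of_nonneg (fun _ => by positivity)).1 hp') j
      simpa using this
    have hY0 : Y = 0 := by
      refine ContinuousLinearMap.ext_on (s := Set.range b) ?_ ?_
      · have := b.dense_span
        exact Submodule.dense_iff_topologicalClosure_eq_top.2 this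
      · rintro _ ⟨j, rfl⟩
        exact hYb j
    refine ⟨rankOne ℂ (b i) (b i), ?_, ?_⟩
    · refine isDensityOperator_of_hasSum (isPositive_rankOne_self _) b ?_
      have h1 : ∀ j, inner ℂ (b j) (rankOne ℂ (b i) (b i) (b j)) =
          inner ℂ (b i) (b j) * inner ℂ (b j) (b i) := by
        intro j
        rw [rankOne_apply, inner_smul_right]
      simp only [h1]
      have h2 := b.hasSum_inner_mul_inner (b i) (b i)
      rw [inner_self_ofReal, b.orthonormal.1 i] at h2
      simpa using h2
    · rw [← h, ← hYG, hY0]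
      simp
  · refine ⟨((p⁻¹ : ℝ) : ℂ) • G, ?_, ?_⟩
    · refine isDensityOperator_of_hasSum (hG.smul_of_nonneg ?_) b ?_
      · exact_mod_cast (inv_pos.2 h).le
      · simp only [_root_.smul_apply, inner_smul_right, inner_sqrt_self hY hYG]
        have := hp.mul_left ((p⁻¹ : ℝ) : ℂ)
        rwa [← Complex.ofReal_mul, inv_mul_cancel₀ h.ne', Complex.ofReal_one] at this
    · rw [smul_smul, ← Complex.ofReal_mul, mul_inv_cancel₀ h.ne', Complex.ofReal_one, one_smul]

variable {K : Type*} [NormedAddCommGroup K] [InnerProductSpace ℂ K] [CompleteSpace K]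

lemma NormalState.expect_proj (s : NormalState K) {q : K →L[ℂ] K} (hq : IsStarProjection q) :
    HasSum (fun i => ‖q (s.vec i)‖ ^ 2) (s.expect q).re ∧
      ((s.expect q).re : ℂ) = s.expect q := by
  have h := s.expect_star_mul q
  rwa [hq.isSelfAdjoint.star_eq, hq.isIdempotentElem.eq] at h

instance completeSpace_range (q : K →L[ℂ] K) [hq : Fact (IsStarProjection q)] :
    CompleteSpace (LinearMap.range (q : K →ₗ[ℂ] K)) :=
  (IsIdempotentElem.isClosed_range hq.out.isIdempotentElem).completeSpace_coe

lemma proj_apply_coe {q : K →L[ℂ] K} (hq : IsStarProjection q)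
    (f : LinearMap.range (q : K →ₗ[ℂ] K)) : q f = f := by
  obtain ⟨_, v, rfl⟩ := f
  exact hq.apply_apply v

section Range

variable (q : K →L[ℂ] K) [hq : Fact (IsStarProjection q)]

/-- The inclusion of the range of a projection. -/
noncomputable def rangeIncl : LinearMap.range (q : K →ₗ[ℂ] K) →L[ℂ] K :=
  (LinearMap.range (q : K →ₗ[ℂ] K)).subtypeL

/-- The compression of an operator to the range of a projection. -/
noncomputable def compress (X : K →L[ℂ] K) :
    LinearMap.range (q : K →ₗ[ℂ] K) →L[ℂ] LinearMap.range (q : K →ₗ[ℂ] K) :=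
  compression (LinearMap.range (q : K →ₗ[ℂ] K)) X

lemma coe_adjoint_rangeIncl (v : K) : (adjoint (rangeIncl q) v : K) = q v := by
  have h : adjoint (rangeIncl q) v = ⟨q v, v, rfl⟩ := by
    refine ext_inner_left ℂ fun f => ?_
    rw [ContinuousLinearMap.adjoint_inner_right, Submodule.coe_inner]
    change inner ℂ (f : K) v = inner ℂ (f : K) (q v)
    rw [← hq.out.inner_apply, proj_apply_coe hq.out]
  rw [h]

lemma coe_compress (X : K →L[ℂ] K) (f : LinearMap.range (q : K →ₗ[ℂ] K)) :
    (compress q X f : K) = q (X f) := coe_adjoint_rangeIncl q _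

lemma inner_compress (X : K →L[ℂ] K) (f g : LinearMap.range (q : K →ₗ[ℂ] K)) :
    inner ℂ f (compress q X g) = inner ℂ (f : K) (X g) := inner_compression _ X f g

lemma adjoint_compress (X : K →L[ℂ] K) : adjoint (compress q X) = compress q (adjoint X) :=
  adjoint_compression _ X

lemma isPositive_compress {X : K →L[ℂ] K} (hX : X.IsPositive) : (compress q X).IsPositive :=
  hX.adjoint_conj (rangeIncl q)

/-- The expectation value of a projection is the trace of the block of the state on its range. -/
lemma hasSum_expect_basis (s : NormalState K) {ι : Type*}
    (b : HilbertBasis ι ℂ (LinearMap.range (q : K →ₗ[ℂ] K))) :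
    HasSum (fun i => s.expect (rankOne ℂ (b i : K) (b i : K))) ((s.expect q).re : ℂ) := by
  have e : (fun i => s.expect (rankOne ℂ (b i : K) (b i : K))) =
      fun i => (((s.expect (rankOne ℂ (b i : K) (b i : K))).re : ℝ) : ℂ) :=
    funext fun i => (s.expect_rankOne_self _).2.symm
  rw [e]
  refine Complex.hasSum_ofReal.2 (hasSum_swap (fun _ _ => by positivity)
    (fun i => (s.expect_rankOne_self (b i : K)).1) (fun j => ?_) (s.expect_proj hq.out).1)
  have h := hasSum_norm_inner_sq b (adjoint (rangeIncl q) (s.vec j))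
  simp only [ContinuousLinearMap.adjoint_inner_right] at h
  have h2 : ‖adjoint (rangeIncl q) (s.vec j)‖ = ‖q (s.vec j)‖ := by
    rw [← coe_adjoint_rangeIncl, Submodule.coe_norm]
  rw [h2] at h
  exact h

end Range

lemma orthogonalFamily_range {α : Type*} {Q : α → K →L[ℂ] K} (hQ : ∀ i, IsStarProjection (Q i))
    (horth : ∀ i j, i ≠ j → Q i * Q j = 0) :
    OrthogonalFamily ℂ (fun i => LinearMap.range (Q i : K →ₗ[ℂ] K))
      fun i => (LinearMap.range (Q i : K →ₗ[ℂ] K)).subtypeₗᵢ := by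
  intro i j hij v w
  change inner ℂ (v : K) (w : K) = 0
  rw [← proj_apply_coe (hQ i) v, ← proj_apply_coe (hQ j) w, (hQ i).inner_apply,
    ← mul_apply_eq_comp, horth i j hij, _root_.zero_apply, inner_zero_right]

/-- Parseval's identity for a total family of mutually orthogonal projections. -/
lemma hasSum_norm_sq_proj {α : Type*} {Q : α → K →L[ℂ] K} (hQ : ∀ i, IsStarProjection (Q i))
    (horth : ∀ i j, i ≠ j → Q i * Q j = 0) (htotal : ∀ v, (∀ i, Q i v = 0) → v = 0) (x : K) :
    HasSum (fun i => ‖Q i x‖ ^ 2) (‖x‖ ^ 2) := by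
  have : ∀ i, Fact (IsStarProjection (Q i)) := fun i => ⟨hQ i⟩
  have hV := IsHilbertSum.mkInternal (fun i => LinearMap.range (Q i : K →ₗ[ℂ] K))
    (orthogonalFamily_range hQ horth) (by
      rw [top_le_iff, Submodule.topologicalClosure_eq_top_iff, eq_bot_iff]
      intro v hv
      rw [Submodule.mem_orthogonal] at hv
      refine htotal v fun i => ?_
      have h1 := hv (Q i v) (Submodule.mem_iSup_of_mem i ⟨v, rfl⟩)
      rw [(hQ i).inner_apply, (hQ i).inner_self] at h1
      simpa using h1)
  set w := hV.linearIsometryEquiv x with hw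
  have hx : hV.linearIsometryEquiv.symm w = x := LinearIsometryEquiv.symm_apply_apply _ _
  have hsum := hV.hasSum_linearIsometryEquiv_symm w
  rw [hx] at hsum
  have hcoord : ∀ i, Q i x = (w i : K) := by
    intro i
    refine (hsum.mapL (Q i)).unique ?_
    convert hasSum_single i ?_ using 1
    · exact (proj_apply_coe (hQ i) (w i)).symm
    · intro j hj
      change Q i (w j : K) = 0
      rw [← proj_apply_coe (hQ j) (w j), ← mul_apply_eq_comp, horth i j (Ne.symm hj),
        _root_.zero_apply]
  have hinner := lp.hasSum_inner (𝕜 := ℂ) w w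
  simp only [inner_self_ofReal] at hinner
  have h2 := Complex.hasSum_ofReal.1 hinner
  rw [hw, LinearIsometryEquiv.norm_map, ← hw] at h2
  simp only [hcoord]
  exact h2

lemma NormalState.hasSum_expect_proj (s : NormalState K) {α : Type*} {Q : α → K →L[ℂ] K}
    (hQ : ∀ i, IsStarProjection (Q i)) (horth : ∀ i j, i ≠ j → Q i * Q j = 0)
    (htotal : ∀ v, (∀ i, Q i v = 0) → v = 0) : HasSum (fun i => (s.expect (Q i)).re) 1 :=
  hasSum_swap (fun _ _ => by positivity) (fun i => (s.expect_proj (hQ i)).1)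
    (fun j => hasSum_norm_sq_proj hQ horth htotal (s.vec j)) s.hasSum_norm_sq

end Traces

/-! ### The states of the clockwork and of the display -/

section States

/-- Every irreducible subspace carries a state `ω`, independent of `t` and invariant under the
restricted measurement, to which all blocks of the invariant density operators are proportional. -/
theorem ConditionalExpectation.exists_fiber_state {K : Type*} [NormedAddCommGroup K]
    [InnerProductSpace ℂ K] [CompleteSpace K] {κ T : Type*} {A : κ → K →L[ℂ] K}
    {s : T → NormalState K} (E : ConditionalExpectation A s)
    (hfaith : ∀ X : K →L[ℂ] K, (∀ t i, X ((s t).vec i) = 0) → X = 0) {ρ : T → K →L[ℂ] K}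
    (hpos : ∀ t, (ρ t).IsPositive) (hrep : ∀ t, (s t).Represents (ρ t))
    (hinv : ∀ t, Preserves A (ρ t)) {p : K →L[ℂ] K} [hpp : Fact (IsStarProjection p)]
    (hp : IsIrreducibleProj A p) :
    ∃ ω : LinearMap.range (p : K →ₗ[ℂ] K) →L[ℂ] LinearMap.range (p : K →ₗ[ℂ] K),
      IsDensityOperator ω ∧ Preserves (fun k => compress p (A k)) ω ∧
      ∀ w₁ ∈ commutant A, ∀ w₂ ∈ commutant A, w₂ * p = w₂ →
        ∀ (f f' : LinearMap.range (p : K →ₗ[ℂ] K)) (t : T),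
        inner ℂ (w₁ f) (ρ t (w₂ f')) = (s t).expect (w₂ * star w₁) * inner ℂ f (ω f') := by
  obtain ⟨B, hB⟩ := E.exists_form hrep hp
  -- `ω` is the normalised block of a state `ρ t₀` that does not vanish on the subspace
  obtain ⟨t₀, ht₀⟩ : ∃ t, (s t).expect p ≠ 0 := by
    by_contra! h
    refine hp.ne_zero (hfaith p fun t i => ?_)
    have h1 := ((s t).expect_proj hp.isStarProjection).1
    rw [h t, Complex.zero_re] at h1
    have := congrFun ((hasSum_zero_iff_of_nonneg (fun _ => by positivity)).1 h1) i
    simpa using this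
  set c : ℝ := ((s t₀).expect p).re with hc
  have hcp : (c : ℂ) = (s t₀).expect p := ((s t₀).expect_proj hp.isStarProjection).2
  have hc0 : (c : ℂ) ≠ 0 := hcp ▸ ht₀
  obtain ⟨v, hv, hv1⟩ := hp.exists_unit
  obtain ⟨b, ⟨g⟩⟩ := exists_basis (LinearMap.range (p : K →ₗ[ℂ] K))
  have hne : Nonempty b := by
    by_contra hcon
    rw [not_nonempty_iff] at hcon
    have h1 := (hasSum_norm_inner_sq g ⟨v, v, hv⟩).unique hasSum_empty
    rw [Submodule.coe_norm] at h1
    change ‖v‖ ^ 2 = 0 at h1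
    rw [hv1] at h1
    norm_num at h1
  obtain ⟨-, ω, hω, hωρ⟩ := exists_isDensityOperator_smul (isPositive_compress p (hpos t₀)) g hne
    (p := c) (by
      have e : ∀ x y, inner ℂ x (ρ t₀ y) = (s t₀).expect (rankOne ℂ y x) :=
        fun x y => (hrep t₀ x y).symm
      simp only [inner_compress, e]
      exact hasSum_expect_basis p (s t₀) g)
  have hωB : ∀ f f' : LinearMap.range (p : K →ₗ[ℂ] K), inner ℂ f (ω f') = B f f' := by
    intro f f'
    have h1 : inner ℂ f (((c : ℂ) • ω) f') = c * B f f' := by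
      rw [hωρ, inner_compress]
      have h2 := hB p hp.mem p hp.mem hp.isStarProjection.isIdempotentElem.eq f f'
        (proj_apply_coe hp.isStarProjection f) (proj_apply_coe hp.isStarProjection f') t₀
      rwa [proj_apply_coe hp.isStarProjection, proj_apply_coe hp.isStarProjection,
        hp.isStarProjection.isSelfAdjoint.star_eq, hp.isStarProjection.isIdempotentElem.eq,
        ← hcp] at h2
    rw [_root_.smul_apply, inner_smul_right] at h1
    exact mul_left_cancel₀ hc0 h1
  refine ⟨ω, hω, ?_, ?_⟩
  · intro x
    have h1 := ((hinv t₀ x).mapL (adjoint (rangeIncl p))).const_smul ((c : ℂ)⁻¹)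
    have h2 : ω = (c : ℂ)⁻¹ • compress p (ρ t₀) := by
      rw [← hωρ, smul_smul, inv_mul_cancel₀ hc0, one_smul]
    have h3 : ∀ k, (compress p (A k) ∘L ω ∘L adjoint (compress p (A k))) x =
        (c : ℂ)⁻¹ • adjoint (rangeIncl p) ((A k ∘L ρ t₀ ∘L adjoint (A k)) x) := by
      intro k
      rw [h2, ContinuousLinearMap.comp_apply, ContinuousLinearMap.comp_apply, _root_.smul_apply,
        map_smul]
      congr 1
      refine Subtype.ext ?_
      rw [coe_compress, coe_compress, adjoint_compress, coe_compress, coe_adjoint_rangeIncl,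
        commutant_apply hp.mem, hp.isStarProjection.apply_apply,
        ← commutant_adjoint_apply hp.mem, proj_apply_coe hp.isStarProjection]
      rfl
    simp only [h3]
    rw [h2]
    exact h1
  · intro w₁ h₁ w₂ h₂ hw₂ f f' t
    rw [hB w₁ h₁ w₂ h₂ hw₂ f f' (proj_apply_coe hp.isStarProjection f)
      (proj_apply_coe hp.isStarProjection f') t, hωB]

variable {J F K : Type u} [NormedAddCommGroup F] [InnerProductSpace ℂ F]
  [NormedAddCommGroup K] [InnerProductSpace ℂ K] [CompleteSpace K] {U : J → F →ₗᵢ[ℂ] K}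

/-- The unitary identification turns the block matrix `m ⊗ ω` into a tensor product operator. -/
lemma inner_isotypic_opTensor (hU : OrthogonalFamily ℂ (fun _ : J => F) U)
    (σ : lp (fun _ : J => ℂ) 2 →L[ℂ] lp (fun _ : J => ℂ) 2) (ω : F →L[ℂ] F) (i j : J) (f f' : F) :
    inner ℂ (U i f) (isotypic hU (opTensor σ ω
      ((lpBasis J j ⊗ₜ[ℂ] f' : (lp (fun _ : J => ℂ) 2) ⊗[ℂ] F) :
        HilbertTensor (lp (fun _ : J => ℂ) 2) F))) =
      inner ℂ (lpBasis J i) (σ (lpBasis J j)) * inner ℂ f (ω f') := by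
  classical
  rw [opTensor_coe_tmul, ← isotypic_single hU i f, LinearIsometry.inner_map_map,
    UniformSpace.Completion.inner_coe, TensorProduct.inner_tmul, lpBasis_apply i]

variable [CompleteSpace F]

lemma IsDensityOperator.exists_inner_pos {ω : F →L[ℂ] F} (hω : IsDensityOperator ω) :
    ∃ (f : F) (μ : ℝ), 0 < μ ∧ inner ℂ f (ω f) = (μ : ℂ) := by
  obtain ⟨b, ⟨g⟩⟩ := exists_basis F
  obtain ⟨Y, hY, hYω⟩ := exists_sqrt hω.isPositive
  by_contra! hcon
  have h1 := hω.hasTrace_one b g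
  have h2 : ∀ i, inner ℂ (g i) (ω (g i)) = 0 := by
    intro i
    by_contra h0
    rw [inner_sqrt_self hY hYω] at h0
    refine hcon (g i) (‖Y (g i)‖ ^ 2) ?_ (inner_sqrt_self hY hYω _)
    exact lt_of_le_of_ne (by positivity) fun h => h0 (by rw [← h, Complex.ofReal_zero])
  simp only [h2] at h1
  exact zero_ne_one (hasSum_zero.unique h1)

/-- If all blocks of a positive operator on an isotypic subspace are multiples of `ω`, then the
coefficients are the matrix elements of a positive operator on `ℓ²(J)`, obtained by slicing with a
vector on which `ω` does not vanish. -/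
lemma exists_clock_state (hU : OrthogonalFamily ℂ (fun _ : J => F) U) (hJ : Nonempty J)
    {ρ : K →L[ℂ] K} (hρ : ρ.IsPositive) {ω : F →L[ℂ] F} (hω : IsDensityOperator ω)
    {m : J → J → ℂ} (hm : ∀ i j f f', inner ℂ (U i f) (ρ (U j f')) = m i j * inner ℂ f (ω f'))
    {r : ℝ} (hr : HasSum (fun i => m i i) (r : ℂ)) :
    0 ≤ r ∧ ∃ σ : lp (fun _ : J => ℂ) 2 →L[ℂ] lp (fun _ : J => ℂ) 2, IsDensityOperator σ ∧
      ∀ i j, (r : ℂ) * inner ℂ (lpBasis J i) (σ (lpBasis J j)) = m i j := by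
  classical
  obtain ⟨f, μ, hμ, hf⟩ := hω.exists_inner_pos
  set G : lp (fun _ : J => ℂ) 2 →L[ℂ] lp (fun _ : J => ℂ) 2 :=
    ((μ⁻¹ : ℝ) : ℂ) • (adjoint (isotypicSlice hU f) ∘L ρ ∘L isotypicSlice hU f) with hG
  have hGpos : G.IsPositive := by
    refine (hρ.adjoint_conj (isotypicSlice hU f)).smul_of_nonneg ?_
    exact_mod_cast (inv_pos.2 hμ).le
  have hGm : ∀ i j, inner ℂ (lpBasis J i) (G (lpBasis J j)) = m i j := by
    intro i j
    rw [hG, _root_.smul_apply, inner_smul_right, ContinuousLinearMap.comp_apply,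
      ContinuousLinearMap.adjoint_inner_right, ContinuousLinearMap.comp_apply, lpBasis_apply,
      lpBasis_apply, isotypicSlice_single, isotypicSlice_single, hm, hf, Complex.ofReal_inv]
    have : (μ : ℂ) ≠ 0 := by exact_mod_cast hμ.ne'
    field_simp
  obtain ⟨hr0, σ, hσ, hσG⟩ := exists_isDensityOperator_smul hGpos (lpBasis J) hJ
    (p := r) (by simpa only [hGm] using hr)
  refine ⟨hr0, σ, hσ, fun i j => ?_⟩
  rw [← hGm, ← hσG, _root_.smul_apply, inner_smul_right]

end States

/-! ### The splitting for a total family of states -/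

section Total

variable {K : Type u} [NormedAddCommGroup K] [InnerProductSpace ℂ K] [CompleteSpace K]
  {κ T : Type*} {A : κ → K →L[ℂ] K} {s : T → NormalState K}

/-- The irreducible subspaces sorted into isotypic families: for each class `n` a representative
`P n` and partial isometries `W n i` in the commutant from `P n` onto the members of the class. -/
theorem ConditionalExpectation.exists_isotypic_family (E : ConditionalExpectation A s)
    (hfaith : ∀ X : K →L[ℂ] K, (∀ t i, X ((s t).vec i) = 0) → X = 0) :
    ∃ (ι : Type u) (J : ι → Type u) (P : ι → K →L[ℂ] K) (W : ∀ n, J n → K →L[ℂ] K),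
      (∀ n, IsIrreducibleProj A (P n)) ∧ (∀ n, Nonempty (J n)) ∧
      (∀ n i, W n i ∈ commutant A) ∧ (∀ n i, star (W n i) * W n i = P n) ∧
      (∀ n i, IsStarProjection (W n i * star (W n i))) ∧
      (∀ n m, n ≠ m → ¬ ProjEquiv A (P n) (P m)) ∧
      (∀ n i j, i ≠ j → star (W n i) * W n j = 0) ∧
      (∀ n m i j, n ≠ m → star (W n i) * W m j = 0) ∧
      (∀ v, (∀ n i, star (W n i) v = 0) → v = 0) := by
  obtain ⟨I, hirr, horth, htotal⟩ := E.exists_irreducible_family hfaith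
  let R : Setoid I :=
    ⟨fun p q => ProjEquiv A p q, fun p => ProjEquiv.refl (hirr p p.2), fun h => h.symm,
      fun {p _ r} h h' => h.trans (hirr p p.2) (hirr r r.2) h'⟩
  have hmem : ∀ (n : Quotient R) (i : {i : I // Quotient.mk R i = n}),
      ProjEquiv A (n.out : I) (i : I) := by
    rintro n ⟨i, rfl⟩
    exact Quotient.exact (s := R) (Quotient.out_eq _)
  choose W hWmem hWP hWQ using hmem
  have hQW : ∀ (n : Quotient R) (i : {i : I // Quotient.mk R i = n}),
      (i.1 : K →L[ℂ] K) * W n i = W n i := fun n i =>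
    mul_of_mul_star_eq (hirr _ i.1.2).isStarProjection (hWQ n i)
  have hWQ' : ∀ (n : Quotient R) (i : {i : I // Quotient.mk R i = n}),
      star (W n i) * (i.1 : K →L[ℂ] K) = star (W n i) := by
    intro n i
    have := congrArg star (hQW n i)
    rwa [star_mul, (hirr _ i.1.2).isStarProjection.isSelfAdjoint.star_eq] at this
  have hzero : ∀ (n m : Quotient R) (i : {i : I // Quotient.mk R i = n})
      (j : {i : I // Quotient.mk R i = m}), i.1 ≠ j.1 → star (W n i) * W m j = 0 := by
    intro n m i j hij
    rw [← hWQ', ← hQW m j, mul_assoc, ← mul_assoc (i.1 : K →L[ℂ] K),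
      horth _ i.1.2 _ j.1.2 (fun h => hij (Subtype.ext h)), zero_mul, mul_zero]
  refine ⟨Quotient R, fun n => {i : I // Quotient.mk R i = n}, fun n => (n.out : I), W,
    fun n => hirr _ n.out.2, fun n => ⟨⟨n.out, Quotient.out_eq n⟩⟩, hWmem, hWP, ?_, ?_, ?_, ?_, ?_⟩
  · intro n i
    rw [hWQ]
    exact (hirr _ i.1.2).isStarProjection
  · intro n m hnm h
    refine hnm ?_
    rw [← Quotient.out_eq n, ← Quotient.out_eq m]
    exact Quotient.sound h
  · intro n i j hij
    exact hzero n n i j fun h => hij (Subtype.ext h)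
  · intro n m i j hnm
    refine hzero n m i j fun h => hnm ?_
    rw [← i.2, ← j.2, h]
  · intro v hv
    refine htotal v fun p hp => ?_
    have h1 := hv (Quotient.mk R ⟨p, hp⟩) ⟨⟨p, hp⟩, rfl⟩
    have h2 : p = W (Quotient.mk R ⟨p, hp⟩) ⟨⟨p, hp⟩, rfl⟩ *
        star (W (Quotient.mk R ⟨p, hp⟩) ⟨⟨p, hp⟩, rfl⟩) := 
      (hWQ (Quotient.mk R ⟨p, hp⟩) ⟨⟨p, hp⟩, rfl⟩).symm
    rw [h2, mul_apply_eq_comp, h1, map_zero]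

lemma inner_apply_apply (w w' : K →L[ℂ] K) (u v : K) :
    inner ℂ (w u) (w' v) = inner ℂ u ((star w * w') v) := by
  rw [mul_apply_eq_comp, star_eq_adjoint, ContinuousLinearMap.adjoint_inner_right]

/-- The structure theorem when the states are supported on the whole space. -/
theorem exists_splitting (ρ : T → K →L[ℂ] K) (A : κ → K →L[ℂ] K)
    (hρ : ∀ t, IsDensityOperator (ρ t)) (hA : IsKrausFamily A) (hinv : ∀ t, Preserves A (ρ t))
    (hdense : ∀ v, (∀ t x, inner ℂ (ρ t x) v = 0) → v = 0) :
    ∃ (D : TensorSplitting K) (p : D.ι → T → ℝ) (σ : ∀ n : D.ι, T → D.C n →L[ℂ] D.C n)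
      (ω : ∀ n : D.ι, D.F n →L[ℂ] D.F n) (a : κ → ∀ n : D.ι, D.F n →L[ℂ] D.F n),
      (∀ n t, 0 ≤ p n t) ∧ (∀ t, HasSum (fun n => p n t) 1) ∧
      (∀ n t, IsDensityOperator (σ n t)) ∧ (∀ n, IsDensityOperator (ω n)) ∧
      (∀ t n v, ρ t (D.incl n v) = D.incl n (((p n t : ℂ) • opTensor (σ n t) (ω n)) v)) ∧
      (∀ k n v, A k (D.incl n v) =
        D.incl n (opTensor (ContinuousLinearMap.id ℂ (D.C n)) (a k n) v)) ∧
      (∀ n, Preserves (fun k => a k n) (ω n)) := by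
  classical
  choose s hrep hsinv using fun t => exists_normalState hA (hρ t) (hinv t)
  have hfaith : ∀ X : K →L[ℂ] K, (∀ t i, X ((s t).vec i) = 0) → X = 0 := by
    intro X hX
    have h1 : adjoint X = 0 := by
      ext v
      refine hdense _ fun t x => ?_
      rw [ContinuousLinearMap.adjoint_inner_right, (hrep t).apply_eq_zero (hX t),
        inner_zero_left]
    rw [← ContinuousLinearMap.adjoint_adjoint X, h1, map_zero]
  obtain ⟨E⟩ := exists_conditionalExpectation hA hsinv hfaith
  obtain ⟨ι, J, P, W, hP, hJ, hW, hWP, hWQ, hPP, hWorth, hWorth', hWtotal⟩ :=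
    E.exists_isotypic_family hfaith
  have hfact : ∀ n, Fact (IsStarProjection (P n)) := fun n => ⟨(hP n).isStarProjection⟩
  have hWmul : ∀ n i, W n i * P n = W n i := fun n i =>
    mul_of_star_mul_eq (hP n).isStarProjection (hWP n i)
  let U : ∀ n, J n → LinearMap.range (P n : K →ₗ[ℂ] K) →ₗᵢ[ℂ] K := fun n i =>
    { ((W n i : K →ₗ[ℂ] K) ∘ₗ (LinearMap.range (P n : K →ₗ[ℂ] K)).subtype) with
      norm_map' := fun f => by
        change ‖W n i (f : K)‖ = ‖(f : K)‖
        have h1 := inner_apply_apply (W n i) (W n i) (f : K) (f : K)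
        rw [hWP, proj_apply_coe (hP n).isStarProjection, inner_self_ofReal, inner_self_ofReal] at h1
        exact (sq_eq_sq₀ (norm_nonneg _) (norm_nonneg _)).1 (by exact_mod_cast h1) }
  have hUW : ∀ n i f, U n i f = W n i (f : K) := fun _ _ _ => rfl
  have hU : ∀ n, OrthogonalFamily ℂ (fun _ : J n => LinearMap.range (P n : K →ₗ[ℂ] K)) (U n) := by
    intro n i j hij f g
    rw [hUW, hUW, inner_apply_apply, hWorth n i j hij, _root_.zero_apply, inner_zero_right]
  have horth : ∀ n m, n ≠ m → ∀ i j f g, inner ℂ (U n i f) (U m j g) = 0 := by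
    intro n m hnm i j f g
    rw [hUW, hUW, inner_apply_apply, hWorth' n m i j hnm, _root_.zero_apply, inner_zero_right]
  have htotal : ∀ v, (∀ n i f, inner ℂ (U n i f) v = 0) → v = 0 := by
    intro v hv
    refine hWtotal v fun n i => ?_
    have h1 : P n (star (W n i) v) = star (W n i) v := by
      have := congrArg star (hWmul n i)
      rw [star_mul, (hP n).isStarProjection.isSelfAdjoint.star_eq] at this
      exact DFunLike.congr_fun this v
    have h2 := hv n i ⟨star (W n i) v, _, h1⟩
    rw [hUW] at h2
    change inner ℂ (W n i (star (W n i) v)) v = 0 at h2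
    rw [← ContinuousLinearMap.adjoint_inner_right, ← star_eq_adjoint] at h2
    exact inner_self_eq_zero.1 h2
  choose ω hω hωinv hωblock using fun n =>
    E.exists_fiber_state hfaith (fun t => (hρ t).isPositive) hrep hinv (hP n)
  -- the probability of the class `n` is the sum of the weights of its members
  have hsum : ∀ t, HasSum (fun x : Σ n, J n =>
      ((s t).expect (W x.1 x.2 * star (W x.1 x.2))).re) 1 := by
    intro t
    refine (s t).hasSum_expect_proj (Q := fun x : Σ n, J n => W x.1 x.2 * star (W x.1 x.2))
      (fun x => hWQ x.1 x.2) ?_ ?_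
    · rintro ⟨n, i⟩ ⟨m, j⟩ hne
      have h0 : star (W n i) * W m j = 0 := by
        by_cases hnm : n = m
        · subst hnm
          exact hWorth n i j fun h => hne (by rw [h])
        · exact hWorth' n m i j hnm
      rw [mul_assoc, ← mul_assoc (star (W n i)), h0, zero_mul, mul_zero]
    · intro v hv
      refine hWtotal v fun n i => ?_
      have h1 := congrArg (fun u => star (W n i) u) (hv ⟨n, i⟩)
      simp only [← mul_apply_eq_comp, map_zero] at h1
      rw [← mul_assoc, hWP] at h1
      have := congrArg star (hWmul n i)
      rw [star_mul, (hP n).isStarProjection.isSelfAdjoint.star_eq] at this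
      rwa [this] at h1
  let p : ι → T → ℝ := fun n t => ∑' i, ((s t).expect (W n i * star (W n i))).re
  have hpn : ∀ n t, HasSum (fun i => ((s t).expect (W n i * star (W n i))).re) (p n t) :=
    fun n t => ((hsum t).summable.sigma_factor n).hasSum
  have hblock : ∀ n t i j f f', inner ℂ (U n i f) (ρ t (U n j f')) =
      (s t).expect (W n j * star (W n i)) * inner ℂ f (ω n f') :=
    fun n t i j f f' => hωblock n _ (hW n i) _ (hW n j) (hWmul n j) f f' t
  have hclock := fun n t => exists_clock_state (hU n) (hJ n) (hρ t).isPositive (hω n)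
    (m := fun i j => (s t).expect (W n j * star (W n i))) (hblock n t) (r := p n t) (by
      have h1 := Complex.hasSum_ofReal.2 (hpn n t)
      have e : (fun i => (((s t).expect (W n i * star (W n i))).re : ℂ)) =
          fun i => (s t).expect (W n i * star (W n i)) :=
        funext fun i => ((s t).expect_proj (hWQ n i)).2
      rwa [e] at h1)
  choose hp0 σ hσ hσm using hclock
  have hρincl : ∀ t n v, ρ t (isotypic (hU n) v) =
      isotypic (hU n) (((p n t : ℂ) • opTensor (σ n t) (ω n)) v) := by
    intro t n v
    have hext : ρ t ∘L (isotypic (hU n)).toContinuousLinearMap =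
        (isotypic (hU n)).toContinuousLinearMap ∘L ((p n t : ℂ) • opTensor (σ n t) (ω n)) := by
      refine isotypic_ext fun j f' => ?_
      refine sub_eq_zero.1 (htotal _ fun m i f => ?_)
      rw [inner_sub_right, sub_eq_zero]
      change inner ℂ (U m i f) (ρ t (isotypic (hU n) _)) =
        inner ℂ (U m i f) (isotypic (hU n) ((p n t : ℂ) • opTensor (σ n t) (ω n) _))
      rw [isotypic_single, map_smul, inner_smul_right]
      by_cases hmn : m = n
      · subst hmn
        have h1 := inner_isotypic_opTensor (hU m) (σ m t) (ω m) i j f f'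
        rw [hblock, ← hσm]
        rw [lpBasis_apply j] at h1 ⊢
        rw [h1, mul_assoc]
      · have h1 : inner ℂ (U m i f) (isotypic (hU n) (opTensor (σ n t) (ω n)
            (((lp.single 2 j (1 : ℂ) : lp (fun _ : J n => ℂ) 2) ⊗ₜ[ℂ] f' :
              (lp (fun _ : J n => ℂ) 2) ⊗[ℂ] _) :
              HilbertTensor (lp (fun _ : J n => ℂ) 2) _))) = 0 := by
          have := (isHilbertSum_isotypic hU horth htotal).OrthogonalFamily hmn
          rw [← isotypic_single (hU m) i f]
          exact this _ _
        rw [h1, mul_zero]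
        exact E.inner_eq_zero hrep (hP m) (hP n) (hPP m n hmn) (hW m i) (hW n j)
          (proj_apply_coe (hP m).isStarProjection f) (proj_apply_coe (hP n).isStarProjection f') t
    exact DFunLike.congr_fun hext v
  have hAincl : ∀ k n v, A k (isotypic (hU n) v) = isotypic (hU n)
      (opTensor (ContinuousLinearMap.id ℂ (lp (fun _ : J n => ℂ) 2)) (compress (P n) (A k)) v) := by
    intro k n v
    refine isotypic_intertwines (hU n) (A k) (compress (P n) (A k)) (fun i f => ?_) v
    rw [hUW, hUW, coe_compress, commutant_apply (hW n i)]
    exact (DFunLike.congr_fun (hWmul n i) (A k f)).symm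
  let a : κ → ∀ n, LinearMap.range (P n : K →ₗ[ℂ] K) →L[ℂ] LinearMap.range (P n : K →ₗ[ℂ] K) :=
    fun k n => compress (P n) (A k)
  refine ⟨splittingOfFamily hU horth htotal, p, σ, ω, a, hp0,
    fun t => (hsum t).sigma fun n => hpn n t, hσ, hω, fun t n v => ?_, fun k n v => ?_, hωinv⟩
  · exact (congrArg (ρ t) (splittingOfFamily_incl hU horth htotal n v)).trans
      ((hρincl t n v).trans (splittingOfFamily_incl hU horth htotal n _).symm)
  · exact (congrArg (A k) (splittingOfFamily_incl hU horth htotal n v)).trans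
      ((hAincl k n v).trans (splittingOfFamily_incl hU horth htotal n _).symm)

end Total

/-! ### Restriction to the joint support -/

section Support

variable {H : Type u} [NormedAddCommGroup H] [InnerProductSpace ℂ H] {T κ : Type*}
  {ρ : T → H →L[ℂ] H} {A : κ → H →L[ℂ] H}

lemma mem_orthogonal_jointSupport {v : H} :
    v ∈ (jointSupport ρ)ᗮ ↔ ∀ t x, inner ℂ (ρ t x) v = 0 := by
  rw [jointSupport, Submodule.orthogonal_closure, ← Submodule.iInf_orthogonal, Submodule.mem_iInf]
  refine forall_congr' fun t => ?_
  rw [Submodule.mem_orthogonal]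
  constructor
  · exact fun h x => h _ ⟨x, rfl⟩
  · rintro h _ ⟨x, rfl⟩
    exact h x

lemma apply_mem_jointSupport (t : T) (x : H) : ρ t x ∈ jointSupport ρ :=
  Submodule.le_topologicalClosure _ (Submodule.mem_iSup_of_mem t ⟨x, rfl⟩)

lemma apply_eq_zero_of_mem_orthogonal (hρ : ∀ t, (ρ t).IsPositive) {v : H}
    (hv : v ∈ (jointSupport ρ)ᗮ) (t : T) : ρ t v = 0 := by
  refine ext_inner_left ℂ fun x => ?_
  rw [inner_zero_right, ← mem_orthogonal_jointSupport.1 hv t x]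
  exact ((hρ t).isSymmetric x v).symm

variable [CompleteSpace H]

instance completeSpace_jointSupport : CompleteSpace (jointSupport ρ) :=
  (Submodule.isClosed_topologicalClosure _).completeSpace_coe

/-- If `ρ t v = 0` then all the nonnegative terms of
`∑ k, ⟪(A k)† v, ρ t ((A k)† v)⟫ = ⟪v, ρ t v⟫` vanish. -/
lemma adjoint_apply_mem_orthogonal (hρ : ∀ t, (ρ t).IsPositive)
    (hinv : ∀ t, Preserves A (ρ t)) {v : H} (hv : v ∈ (jointSupport ρ)ᗮ) (k : κ) :
    adjoint (A k) v ∈ (jointSupport ρ)ᗮ := by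
  refine mem_orthogonal_jointSupport.2 fun t x => ?_
  obtain ⟨S, hS, hSρ⟩ := exists_sqrt (hρ t)
  have h1 := (hinv t v).mapL (innerSL ℂ v)
  have h2 : ∀ k, innerSL ℂ v ((A k ∘L ρ t ∘L adjoint (A k)) v) =
      ((‖S (adjoint (A k) v)‖ ^ 2 : ℝ) : ℂ) := by
    intro k
    rw [innerSL_apply_apply, ContinuousLinearMap.comp_apply, ContinuousLinearMap.comp_apply,
      ← ContinuousLinearMap.adjoint_inner_left, inner_sqrt_self hS hSρ]
  simp only [h2] at h1
  rw [apply_eq_zero_of_mem_orthogonal hρ hv, map_zero, ← Complex.ofReal_zero,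
    Complex.hasSum_ofReal] at h1
  have h3 := congrFun ((hasSum_zero_iff_of_nonneg (fun _ => by positivity)).1 h1) k
  have h4 : S (adjoint (A k) v) = 0 := by simpa using h3
  have h5 := (hρ t).isSymmetric x (adjoint (A k) v)
  refine h5.trans ?_
  change inner ℂ x (ρ t (adjoint (A k) v)) = 0
  rw [← hSρ, ContinuousLinearMap.comp_apply, h4, map_zero, inner_zero_right]

lemma kraus_apply_mem_jointSupport (hρ : ∀ t, (ρ t).IsPositive)
    (hinv : ∀ t, Preserves A (ρ t)) {v : H} (hv : v ∈ jointSupport ρ) (k : κ) :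
    A k v ∈ jointSupport ρ := by
  rw [← (jointSupport ρ).orthogonal_orthogonal, Submodule.mem_orthogonal]
  intro u hu
  rw [← ContinuousLinearMap.adjoint_inner_left]
  exact Submodule.inner_left_of_mem_orthogonal hv (adjoint_apply_mem_orthogonal hρ hinv hu k)

end Support

section Compression

variable {H : Type u} [NormedAddCommGroup H] [InnerProductSpace ℂ H] [CompleteSpace H]
  {T κ : Type*}

variable (V : Submodule ℂ H) [CompleteSpace V]

lemma isDensityOperator_compression {ρ : H →L[ℂ] H} (hρ : IsDensityOperator ρ)
    (hV : ∀ v ∈ Vᗮ, ρ v = 0) : IsDensityOperator (compression V ρ) := by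
  obtain ⟨S, hS, hSρ⟩ := exists_sqrt hρ.isPositive
  obtain ⟨b, ⟨g⟩⟩ := exists_basis V
  obtain ⟨c, ⟨e⟩⟩ := exists_basis H
  have hSV : ∀ x, S x ∈ V := by
    intro x
    rw [← V.orthogonal_orthogonal, Submodule.mem_orthogonal]
    intro u hu
    have h1 := inner_sqrt_self hS hSρ u
    rw [hV u hu, inner_zero_right] at h1
    have h2 : S u = 0 := by
      rw [← norm_eq_zero, ← sq_eq_zero_iff]
      exact_mod_cast h1.symm
    rw [← ContinuousLinearMap.adjoint_inner_left, hS, h2, inner_zero_left]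
  refine isDensityOperator_of_hasSum (hρ.isPositive.adjoint_conj V.subtypeL) g ?_
  have h1 := hρ.hasSum_sqrt hS hSρ e
  have h2 : HasSum (fun i => ‖(S ∘L V.subtypeL) (g i)‖ ^ 2) 1 := by
    rw [hasSum_norm_sq_iff zero_le_one] at h1 ⊢
    rw [tsum_enorm_sq_adjoint g e, ← h1]
    refine tsum_congr fun j => ?_
    rw [adjoint_comp, hS, ContinuousLinearMap.comp_apply]
    congr 1
    have := congrArg enorm (coe_adjoint_subtypeL V (hSV (e j)))
    exact this
  have h3 := Complex.hasSum_ofReal.2 h2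
  rw [Complex.ofReal_one] at h3
  convert h3 using 2 with i
  rw [inner_compression, inner_sqrt_self hS hSρ]
  rfl

lemma isKrausFamily_compression {A : κ → H →L[ℂ] H} (hA : IsKrausFamily A)
    (hV : ∀ k, ∀ v ∈ V, A k v ∈ V) : IsKrausFamily fun k => compression V (A k) := by
  intro x
  have h1 := (hA x).mapL (adjoint V.subtypeL)
  have h2 : adjoint V.subtypeL (x : H) = x := Subtype.ext (coe_adjoint_subtypeL V x.2)
  rw [h2] at h1
  convert h1 using 2 with k
  rw [adjoint_compression, ContinuousLinearMap.comp_apply]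
  change adjoint V.subtypeL (adjoint (A k) (compression V (A k) x : H)) = _
  rw [coe_compression V (hV k)]
  rfl

lemma preserves_compression {A : κ → H →L[ℂ] H} {ρ : H →L[ℂ] H} (hinv : Preserves A ρ)
    (hA : ∀ k, ∀ v ∈ V, A k v ∈ V) (hρ : ∀ x, ρ x ∈ V) (hρV : ∀ v ∈ Vᗮ, ρ v = 0) :
    Preserves (fun k => compression V (A k)) (compression V ρ) := by
  intro x
  have h1 := (hinv x).mapL (adjoint V.subtypeL)
  have h3 : ∀ k, (compression V (A k) ∘L compression V ρ ∘L adjoint (compression V (A k))) x =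
      adjoint V.subtypeL ((A k ∘L ρ ∘L adjoint (A k)) x) := ?_
  · simp only [h3]
    exact h1
  intro k
  refine Subtype.ext ?_
  have h2 : ρ (adjoint V.subtypeL (adjoint (A k) x) : H) = ρ (adjoint (A k) x) := by
    rw [← sub_eq_zero, ← map_sub]
    refine hρV _ ?_
    rw [Submodule.mem_orthogonal]
    intro u hu
    have := ContinuousLinearMap.adjoint_inner_right V.subtypeL ⟨u, hu⟩ (adjoint (A k) (x : H))
    rw [inner_sub_right, sub_eq_zero]
    exact this
  rw [adjoint_compression, ContinuousLinearMap.comp_apply, ContinuousLinearMap.comp_apply,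
    coe_compression V (hA k), coe_compression V fun v _ => hρ v]
  change A k (ρ (adjoint V.subtypeL (adjoint (A k) x) : H)) = _
  rw [h2]
  exact (coe_adjoint_subtypeL V (hA k _ (hρ _))).symm

end Compression

end TickingClock


theorem theorem1 {H : Type u} [NormedAddCommGroup H] [InnerProductSpace ℂ H] [CompleteSpace H]
    {T κ : Type*} (ρ : T → H →L[ℂ] H) (A : κ → H →L[ℂ] H)
    (hρ : ∀ t, TickingClock.IsDensityOperator (ρ t))
    (hA : TickingClock.IsKrausFamily A)
    (hinv : ∀ t, TickingClock.Preserves A (ρ t)) :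
    ∃ (D : TickingClock.TensorSplitting (TickingClock.jointSupport ρ))
      (p : D.ι → T → ℝ)
      (σ : ∀ n : D.ι, T → D.C n →L[ℂ] D.C n)
      (ω : ∀ n : D.ι, D.F n →L[ℂ] D.F n)
      (a : κ → ∀ n : D.ι, D.F n →L[ℂ] D.F n),
      (∀ n t, 0 ≤ p n t) ∧
      (∀ t, HasSum (fun n => p n t) 1) ∧
      (∀ n t, TickingClock.IsDensityOperator (σ n t)) ∧
      (∀ n, TickingClock.IsDensityOperator (ω n)) ∧
      (∀ t, D.IsDirectSum (ρ t)
        (fun n => (p n t : ℂ) • TickingClock.opTensor (σ n t) (ω n))) ∧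
      (∀ k, D.IsDirectSum (A k)
        (fun n => TickingClock.opTensor (ContinuousLinearMap.id ℂ (D.C n)) (a k n))) ∧
      (∀ n, TickingClock.Preserves (fun k => a k n) (ω n)) := by
  have hpos := fun t => (hρ t).isPositive
  have hρV := fun t v (hv : v ∈ (TickingClock.jointSupport ρ)ᗮ) =>
    TickingClock.apply_eq_zero_of_mem_orthogonal hpos hv t
  have hρmem := fun t x => TickingClock.apply_mem_jointSupport (ρ := ρ) t x
  have hAmem := fun k v (hv : v ∈ TickingClock.jointSupport ρ) =>
    TickingClock.kraus_apply_mem_jointSupport hpos hinv hv k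
  obtain ⟨D, p, σ, ω, a, hp0, hp1, hσ, hω, hρD, hAD, hωinv⟩ := TickingClock.exists_splitting
    (fun t => TickingClock.compression (TickingClock.jointSupport ρ) (ρ t))
    (fun k => TickingClock.compression (TickingClock.jointSupport ρ) (A k))
    (fun t => TickingClock.isDensityOperator_compression _ (hρ t) (hρV t))
    (TickingClock.isKrausFamily_compression _ hA hAmem)
    (fun t => TickingClock.preserves_compression _ (hinv t) hAmem (hρmem t) (hρV t)) (by
      intro v hv
      have h1 : (v : H) ∈ (TickingClock.jointSupport ρ)ᗮ := by
        refine TickingClock.mem_orthogonal_jointSupport.2 fun t x => ?_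
        -- test with the vector `ρ t v` of the support: `⟪ρ t (ρ t v), v⟫ = ‖ρ t v‖ ^ 2`
        have h2 := hv t ⟨_, hρmem t v⟩
        change inner ℂ (TickingClock.compression _ (ρ t) ⟨_, hρmem t v⟩ : H) (v : H) = 0 at h2
        rw [TickingClock.coe_compression _ fun v _ => hρmem t v] at h2
        have h3 := ((hpos t).isSymmetric (ρ t v) v).symm.trans h2
        have h4 : ρ t v = 0 := inner_self_eq_zero.1 h3
        refine ((hpos t).isSymmetric x v).trans ?_
        change inner ℂ x (ρ t v) = 0
        rw [h4, inner_zero_right]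
      exact Subtype.ext (inner_self_eq_zero.1 (Submodule.inner_right_of_mem_orthogonal v.2 h1)))
  refine ⟨D, p, σ, ω, a, hp0, hp1, hσ, hω, fun t n v => ?_, fun k n v => ?_, hωinv⟩
  · rw [← hρD]
    exact (TickingClock.coe_compression _ (fun v _ => hρmem t v) _).symm
  · rw [← hAD]
    exact (TickingClock.coe_compression _ (hAmem k) _).symm
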